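/- Consider the system $dX_t = AX_t\,dt + BU_t\,dt + dW_t$ in $\mathbb{R}^d$, where $A\in\mathbb{R}^{d\times d}$ and $B\in\mathbb{R}^{d\times p}$ are unknown, $W$ is a standard Brownian motion in $\mathbb{R}^d$, and $\|A\|\le\kappa_A$, $\|B\|\le\kappa_B$ in spectral norm for known constants $\kappa_A>0$ and $\kappa_B$. No stabilizing controller is assumed: $A$ need not be stable. Put $h=\frac{1}{15\kappa_A}$ and let $T_0$ be an integer with $2\le T_0\le 10$. Run $H$ independent trajectories of length $T_0h$: on the $l$-th trajectory the control is $U_t=u^l_k$ for $t\in[kh,(k+1)h)$, $0\le k<T_0$, where the inputs $u^l_k$ are i.i.d. $\mathcal N(0,I_p)$; the initial state, the inputs and the Brownian motion of each trajectory are independent, and the law of the initial state is arbitrary (for instance a fixed vector). Let $x^l_k$ be the state of the $l$-th trajectory at time $kh$. Let $$(\widetilde A,\widetilde B)\in\arg\min_{(M,N)}\ \frac12\sum_{l=1}^{H}\bigl\|x^l_{T_0}-Mx^l_{T_0-1}-Nu^l_{T_0-1}\bigr\|_2^2 ,$$ the minimum being over $M\in\mathbb{R}^{d\times d}$, $N\in\mathbb{R}^{d\times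 p}$, and put $$\hat A=\frac1h\sum_{k\ge1}\frac{(-1)^{k-1}}{k}(\widetilde A-I)^k,\qquad \hat B=\Bigl[\int_0^h e^{\hat At}\,dt\Bigr]^{-1}\widetilde B .$$ There is a constant $C$, given by a polynomial in $\kappa_A$, $\kappa_B$ and the dimensions $d$, $p$ (one fixed polynomial for all systems), such that for every $0<\delta<\frac12$ and every $H\ge C\log(1/\delta)$, with probability at least $1-\delta$ the following holds for every choice of the minimizer $(\widetilde A,\widetilde B)$: the series defining $\hat A$ converges, the matrix $\int_0^h e^{\hat At}\,dt$ is invertible, and $$\|\hat A-A\|\le C\sqrt{\frac{\log(1/\delta)}{H}},\qquad \|\hat B-B\|\le C\sqrt{\frac{\log(1/\delta)}{H}} .$$ -/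

import Mathlib

open MeasureTheory ProbabilityTheory Set
open scoped NNReal Matrix.Norms.L2Operator

/-! Throughout, `‖M‖` for a real matrix `M` is the spectral norm (the operator norm with respect to
the Euclidean norms), which is the scoped norm opened above. -/

namespace ContinuousSysID

/-- A standard Brownian motion in `ℝ^d`: its coordinates are independent standard real Brownian
motions (with almost surely continuous paths, started at `0`). -/
structure IsStdBrownian {Ω : Type*} [MeasurableSpace Ω] {d : ℕ} (μ : Measure Ω)
    (W : ℝ≥0 → Ω → EuclideanSpace ℝ (Fin d)) : Prop where
  measurable : ∀ t, Measurable (W t)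
  coord : ∀ i, IsBrownianReal (fun t ω => W t ω i) μ
  indep : iIndepFun (fun (i : Fin d) (ω : Ω) (t : ℝ≥0) => W t ω i) μ

/-- The piecewise constant control that is equal to `u k` on `[k h, (k + 1) h)` for `k < n`
(and to `0` after time `n h`). -/
noncomputable def holdInput {n p : ℕ} (h : ℝ) (u : Fin n → EuclideanSpace ℝ (Fin p)) (t : ℝ) :
    EuclideanSpace ℝ (Fin p) :=
  if hk : ⌊t / h⌋₊ < n then u ⟨⌊t / h⌋₊, hk⟩ else 0

/-- The path `x` solves `dX_t = A X_t dt + B U_t dt + dW_t` on `[0, T]` with control `U`, driven by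
the path `w`. As the noise is additive, the equation, in integrated form, is an identity between
paths: `X_t = X_0 + ∫₀ᵗ (A X_s + B U_s) ds + W_t`. -/
def SolvesSDE {d p : ℕ} (A : Matrix (Fin d) (Fin d) ℝ) (B : Matrix (Fin d) (Fin p) ℝ) (T : ℝ)
    (U : ℝ → EuclideanSpace ℝ (Fin p)) (w x : ℝ≥0 → EuclideanSpace ℝ (Fin d)) : Prop :=
  ContinuousOn x {t | (t : ℝ) ≤ T} ∧
    ∀ t : ℝ≥0, (t : ℝ) ≤ T →
      x t = x 0 + (∫ s in (0 : ℝ)..t,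
        (Matrix.toEuclideanLin A (x s.toNNReal) + Matrix.toEuclideanLin B (U s))) + w t

/-- The sampling time `k h`. -/
noncomputable def sampleTime (h : ℝ) (k : ℕ) : ℝ≥0 := (k * h).toNNReal

/-- `H` independent trajectories of length `T₀ h` of the system `dX_t = A X_t dt + B U_t dt + dW_t`.
On trajectory `l` the control is `u l k` on `[k h, (k + 1) h)`, with i.i.d. standard Gaussian inputs
`u l k`; the noise `W l` is a standard Brownian motion; and the initial state `X l 0`, the inputs and
the noise are independent. The law of the initial state is arbitrary (it may be deterministic). -/
structure IsExperiment {Ω : Type*} [MeasurableSpace Ω] {d p H T₀ : ℕ} (μ : Measure Ω)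
    (A : Matrix (Fin d) (Fin d) ℝ) (B : Matrix (Fin d) (Fin p) ℝ) (h : ℝ)
    (u : Fin H → Fin T₀ → Ω → EuclideanSpace ℝ (Fin p))
    (W X : Fin H → ℝ≥0 → Ω → EuclideanSpace ℝ (Fin d)) : Prop where
  measurable_initial : ∀ l, Measurable (X l 0)
  measurable_input : ∀ l k, Measurable (u l k)
  law_input : ∀ l k, HasLaw (u l k) (stdGaussian (EuclideanSpace ℝ (Fin p))) μ
  brownian : ∀ l, IsStdBrownian μ (W l)
  indep_trajectories :
    iIndepFun (fun (l : Fin H) (ω : Ω) =>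
      (X l 0 ω, (fun k : Fin T₀ => u l k ω), (fun t : ℝ≥0 => W l t ω))) μ
  indep_initial : ∀ l,
    IndepFun (X l 0) (fun ω => ((fun k : Fin T₀ => u l k ω), (fun t : ℝ≥0 => W l t ω))) μ
  indep_input_noise : ∀ l,
    IndepFun (fun ω (k : Fin T₀) => u l k ω) (fun ω (t : ℝ≥0) => W l t ω) μ
  indep_inputs : ∀ l, iIndepFun (u l) μ
  dynamics : ∀ l, ∀ᵐ ω ∂μ,
    SolvesSDE A B (T₀ * h) (holdInput h fun k => u l k ω) (fun t => W l t ω) (fun t => X l t ω)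

/-- The least-squares loss `½ ∑ₗ ‖yₗ - M xₗ - N vₗ‖²`. -/
noncomputable def lsLoss {d p H : ℕ} (x : Fin H → EuclideanSpace ℝ (Fin d))
    (v : Fin H → EuclideanSpace ℝ (Fin p)) (y : Fin H → EuclideanSpace ℝ (Fin d))
    (M : Matrix (Fin d) (Fin d) ℝ) (N : Matrix (Fin d) (Fin p) ℝ) : ℝ :=
  1 / 2 * ∑ l, ‖y l - Matrix.toEuclideanLin M (x l) - Matrix.toEuclideanLin N (v l)‖ ^ 2

/-- `(M, N)` minimizes the least-squares loss over all pairs of matrices. -/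
def IsLeastSquares {d p H : ℕ} (x : Fin H → EuclideanSpace ℝ (Fin d))
    (v : Fin H → EuclideanSpace ℝ (Fin p)) (y : Fin H → EuclideanSpace ℝ (Fin d))
    (M : Matrix (Fin d) (Fin d) ℝ) (N : Matrix (Fin d) (Fin p) ℝ) : Prop :=
  ∀ (M' : Matrix (Fin d) (Fin d) ℝ) (N' : Matrix (Fin d) (Fin p) ℝ),
    lsLoss x v y M N ≤ lsLoss x v y M' N'

/-- The terms `(-1)^(k-1) / k • (M - I)^k`, `k ≥ 1`, of the logarithm series (index shifted). -/
noncomputable def logTerm {d : ℕ} (M : Matrix (Fin d) (Fin d) ℝ) (k : ℕ) :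
    Matrix (Fin d) (Fin d) ℝ :=
  ((-1 : ℝ) ^ k / (k + 1)) • (M - 1) ^ (k + 1)

/-- The estimator `Â = h⁻¹ ∑_{k ≥ 1} (-1)^(k-1) / k (M - I)^k`. -/
noncomputable def recoverA {d : ℕ} (h : ℝ) (M : Matrix (Fin d) (Fin d) ℝ) :
    Matrix (Fin d) (Fin d) ℝ :=
  h⁻¹ • ∑' k, logTerm M k

/-- The matrix `∫₀ʰ e^{t A} dt`. -/
noncomputable def expIntegral {d : ℕ} (h : ℝ) (A : Matrix (Fin d) (Fin d) ℝ) :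
    Matrix (Fin d) (Fin d) ℝ :=
  ∫ t in (0 : ℝ)..h, NormedSpace.exp (t • A)

/-- The estimator `B̂ = (∫₀ʰ e^{t Â} dt)⁻¹ N`, where `Â` is recovered from `M`. -/
noncomputable def recoverB {d p : ℕ} (h : ℝ) (M : Matrix (Fin d) (Fin d) ℝ)
    (N : Matrix (Fin d) (Fin p) ℝ) : Matrix (Fin d) (Fin p) ℝ :=
  (expIntegral h (recoverA h M))⁻¹ * N

end ContinuousSysID

/-!
The state is sampled at the times `k h`. Variation of constants turns the equation into the exact
recursion `x_{k+1} = e^{hA} x_k + (∫₀ʰ e^{tA} dt) B u_k + e_k` (`sample_step`), where `e_k` is a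
functional of the increments of the Brownian motion after `k h`. Hence the least-squares problem
is a linear regression, with one independent row per trajectory, for `Φ = e^{hA}` and `Γ = (∫₀ʰ
e^{tA} dt) B`. The proof shows that `M` and `N` are within a multiple of `√(log (1/δ) / H)` of `Φ`
and `Γ`, and that the map from `(Φ, Γ)` to `(A, B)` is Lipschitz near the truth
(`recover_stable`): since `h ‖A‖ ≤ 1/15`, the logarithm series converges there and inverts the
exponential, and `∫₀ʰ e^{tA} dt` is within `h/4` of `h I`.

The regression needs no moment or tail assumption on the initial state. Over the last sampling
interval before the state is observed, the Brownian motion is split into its normalized increment,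
a standard Gaussian vector, and an independent Brownian bridge. As the state is affine in that
increment with an invertible gain (`stateMap_eq_bridge_add`, `norm_bridgeGain_sub_one_le`), a
linear change of variables writes each regression vector `(x, u)` as `g + a`, with `g` standard
Gaussian and `a` independent of `g` with arbitrary law. Conditionally on `a`, each column of the
regression matrix is a Gaussian vector in `ℝ^H` up to a vector in a subspace spanned by `n = d +
p` vectors independent of it, so it is at distance at least of order `√H` from the span of the
other columns; this bounds the length of any combination of the columns from below by its
coefficients (`measure_norm_sum_columns_lt`).

The noise vector of the regression is independent of the regression matrix and has independent
sub-Gaussian coordinates, being a limit of linear combinations of Gaussian variables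
(`IsStdBrownian.hasSubgaussianMGF_pathNoise`). Its projection onto the column space, of dimension
at most `n`, is therefore of order `√(log (1/δ))` (`measure_inner_columns_gt`). Comparing the loss
of the minimizer with the loss of the truth then bounds each entry of the error by the quotient of
the two (`abs_entry_le_of_isLeastSquares`). The bound holds for every minimizer at once, because
both events concern all coefficient vectors.

The functionals of paths have to be measurable for the product `σ`-algebra, so that the
independence of the trajectories can be used; the integral of a path is therefore represented by
the limit of its Riemann sums, which agrees with it on continuous paths (`pathIntegral`).
-/

namespace ContinuousSysID

/-! ### Independence of tuples -/

section Independence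

variable {Ω : Type*} [MeasurableSpace Ω] {μ : Measure Ω}

/-- If `X` is independent of `(Y, Z)` and `Y` of `Z`, then `(X, Y)` is independent of `Z`. -/
lemma indepFun_prodMk_left [IsProbabilityMeasure μ] {α β γ : Type*} [MeasurableSpace α]
    [MeasurableSpace β] [MeasurableSpace γ] {X : Ω → α} {Y : Ω → β} {Z : Ω → γ}
    (hX : Measurable X) (hY : Measurable Y) (hZ : Measurable Z)
    (h : IndepFun X (fun ω => (Y ω, Z ω)) μ) (h' : IndepFun Y Z μ) :
    IndepFun (fun ω => (X ω, Y ω)) Z μ := by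
  have hX' : IsProbabilityMeasure (μ.map X) := Measure.isProbabilityMeasure_map hX.aemeasurable
  have hY' : IsProbabilityMeasure (μ.map Y) := Measure.isProbabilityMeasure_map hY.aemeasurable
  have hZ' : IsProbabilityMeasure (μ.map Z) := Measure.isProbabilityMeasure_map hZ.aemeasurable
  have hXY : IndepFun X Y μ := h.comp measurable_id measurable_fst
  rw [indepFun_iff_map_prod_eq_prod_map_map (by fun_prop) (by fun_prop)] at h h' hXY ⊢
  apply (MeasurableEquiv.prodAssoc (α := α) (β := β) (γ := γ)).map_measurableEquiv_injective
  rw [hXY, Measure.prodAssoc_prod, Measure.map_map (by fun_prop) (by fun_prop), ← h', ← h]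
  rfl

/-- If `X` is independent of `(Y, Z)` and `Y` of `Z`, then `Y` is independent of `(X, Z)`. -/
lemma indepFun_prodMk_swap [IsProbabilityMeasure μ] {α β γ : Type*} [MeasurableSpace α]
    [MeasurableSpace β] [MeasurableSpace γ] {X : Ω → α} {Y : Ω → β} {Z : Ω → γ}
    (hX : Measurable X) (hY : Measurable Y) (hZ : Measurable Z)
    (h : IndepFun X (fun ω => (Y ω, Z ω)) μ) (h' : IndepFun Y Z μ) :
    IndepFun Y (fun ω => (X ω, Z ω)) μ := by
  have h1 := indepFun_prodMk_left hX hZ hY (h.comp measurable_id measurable_swap) h'.symm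
  exact h1.symm

/-- Independent pairs of independent variables can be regrouped. -/
lemma indepFun_prodMk_prodMk [IsProbabilityMeasure μ] {α β γ δ : Type*} [MeasurableSpace α]
    [MeasurableSpace β] [MeasurableSpace γ] [MeasurableSpace δ]
    {X : Ω → α} {Y : Ω → β} {Z : Ω → γ} {T : Ω → δ}
    (hX : Measurable X) (hY : Measurable Y) (hZ : Measurable Z) (hT : Measurable T)
    (h : IndepFun (fun ω => (X ω, Y ω)) (fun ω => (Z ω, T ω)) μ) (h1 : IndepFun X Y μ)
    (h2 : IndepFun Z T μ) :
    IndepFun (fun ω => (X ω, Z ω)) (fun ω => (Y ω, T ω)) μ := by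
  have a1 : IndepFun (fun ω => (Z ω, X ω, Y ω)) T μ :=
    indepFun_prodMk_left hZ (hX.prodMk hY) hT
      (indepFun_prodMk_swap (hX.prodMk hY) hZ hT h h2)
      (h.comp measurable_id measurable_snd)
  have a2 : IndepFun (fun ω => (X ω, Z ω)) Y μ := by
    refine indepFun_prodMk_left hX hZ hY ?_ (h.comp measurable_snd measurable_fst).symm
    exact indepFun_prodMk_swap hZ hX hY (h.comp measurable_id measurable_fst).symm h1
  have a3 : IndepFun (fun ω => ((X ω, Z ω), Y ω)) T μ :=
    a1.comp (φ := fun q : γ × α × β => ((q.2.1, q.1), q.2.2)) (by fun_prop) measurable_id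
  have a4 := indepFun_prodMk_swap hT (hX.prodMk hZ) hY a3.symm a2
  exact a4.comp measurable_id measurable_swap

/-- For an independent family of pairs of independent variables, the family of the first components
is independent of the family of the second ones. -/
lemma indepFun_pi_of_iIndepFun_prodMk [IsProbabilityMeasure μ] {ι α β : Type*} [Fintype ι]
    [MeasurableSpace α] [MeasurableSpace β] {A : ι → Ω → α} {B : ι → Ω → β}
    (hA : ∀ i, Measurable (A i)) (hB : ∀ i, Measurable (B i))
    (h : iIndepFun (fun i ω => (A i ω, B i ω)) μ) (h' : ∀ i, IndepFun (A i) (B i) μ) :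
    IndepFun (fun ω i => A i ω) (fun ω i => B i ω) μ := by
  have hA' i : IsProbabilityMeasure (μ.map (A i)) :=
    Measure.isProbabilityMeasure_map (hA i).aemeasurable
  have hB' i : IsProbabilityMeasure (μ.map (B i)) :=
    Measure.isProbabilityMeasure_map (hB i).aemeasurable
  have hiA : iIndepFun A μ := h.comp (fun _ => Prod.fst) (fun _ => measurable_fst)
  have hiB : iIndepFun B μ := h.comp (fun _ => Prod.snd) (fun _ => measurable_snd)
  rw [indepFun_iff_map_prod_eq_prod_map_map (by fun_prop) (by fun_prop),
    hiA.map_fun_eq_pi_map (fun i => (hA i).aemeasurable),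
    hiB.map_fun_eq_pi_map (fun i => (hB i).aemeasurable),
    ← (measurePreserving_arrowProdEquivProdArrow α β ι (fun i => μ.map (A i))
      (fun i => μ.map (B i))).map_eq]
  have := h.map_fun_eq_pi_map (fun i => ((hA i).prodMk (hB i)).aemeasurable)
  have h2 i : μ.map (fun ω => (A i ω, B i ω)) = (μ.map (A i)).prod (μ.map (B i)) :=
    (indepFun_iff_map_prod_eq_prod_map_map (by fun_prop) (by fun_prop)).1 (h' i)
  simp_rw [h2] at this
  rw [← this, Measure.map_map (MeasurableEquiv.measurable _) (by fun_prop)]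
  rfl

/-- Conditioning on the first of two independent variables: a bound for the probability of each
section bounds the probability. -/
lemma measure_le_of_indepFun [IsProbabilityMeasure μ] {α β : Type*}
    [MeasurableSpace α] [MeasurableSpace β] {q : Ω → α} {g : Ω → β} (hq : Measurable q)
    (hg : Measurable g) (h : IndepFun q g μ) {S : Set (α × β)} (hS : MeasurableSet S)
    {ε : ENNReal} (hε : ∀ a, μ.map g {b | (a, b) ∈ S} ≤ ε) :
    μ {ω | (q ω, g ω) ∈ S} ≤ ε := by
  have hq' : IsProbabilityMeasure (μ.map q) := Measure.isProbabilityMeasure_map hq.aemeasurable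
  have hg' : IsProbabilityMeasure (μ.map g) := Measure.isProbabilityMeasure_map hg.aemeasurable
  rw [indepFun_iff_map_prod_eq_prod_map_map (by fun_prop) (by fun_prop)] at h
  change μ ((fun ω => (q ω, g ω)) ⁻¹' S) ≤ ε
  rw [← Measure.map_apply (by fun_prop) hS, h, Measure.prod_apply hS]
  calc ∫⁻ x, (μ.map g) (Prod.mk x ⁻¹' S) ∂(μ.map q) ≤ ∫⁻ _, ε ∂(μ.map q) :=
        lintegral_mono fun a => hε a
    _ = ε := by simp

end Independence

/-! ### Distance of a Gaussian vector to a subspace -/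

section SmallBall

/-- Lower tail of the chi-squared distribution, by the Chernoff bound at `-1`: the Laplace transform
of the square of a standard Gaussian variable at `1` is `1 / √3 ≤ exp (-1/2)`. -/
lemma pi_gaussianReal_sum_sq_lt {ι : Type*} [Fintype ι] [DecidableEq ι] (s : Finset ι) :
    (Measure.pi fun _ : ι => gaussianReal 0 1).real {x | ∑ i ∈ s, x i ^ 2 < (s.card : ℝ) / 4} ≤
      Real.exp (-(s.card : ℝ) / 4) := by
  set P := Measure.pi fun _ : ι => gaussianReal 0 1
  have hG : ∫ x, Real.exp (-x ^ 2) ∂(gaussianReal 0 1) = (√3)⁻¹ := by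
    rw [integral_gaussianReal_eq_integral_smul (by simp)]
    have : ∀ x : ℝ, gaussianPDFReal 0 1 x • Real.exp (-x ^ 2) =
        (√(2 * Real.pi))⁻¹ * Real.exp (-(3 / 2) * x ^ 2) := by
      intro x
      simp only [gaussianPDFReal, smul_eq_mul, NNReal.coe_one, mul_one, sub_zero, mul_assoc,
        ← Real.exp_add]
      congr 2
      ring
    simp_rw [this]
    rw [integral_const_mul, integral_gaussian, ← Real.sqrt_inv, ← Real.sqrt_inv,
      ← Real.sqrt_mul (by positivity)]
    congr 1
    field_simp
  have hf : (fun x : ι → ℝ => Real.exp (1 * -∑ i ∈ s, x i ^ 2)) =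
      fun x => ∏ i, (fun y : ℝ => if i ∈ s then Real.exp (-y ^ 2) else 1) (x i) := by
    ext x
    simp only [Finset.prod_ite_mem, Finset.univ_inter, one_mul, ← Real.exp_sum,
      Finset.sum_neg_distrib]
  have hint : Integrable (fun x : ι → ℝ => Real.exp (1 * -∑ i ∈ s, x i ^ 2)) P := by
    refine Integrable.of_bound (Continuous.aestronglyMeasurable (by fun_prop)) 1 (ae_of_all _ fun x => ?_)
    rw [Real.norm_of_nonneg (Real.exp_pos _).le, Real.exp_le_one_iff]
    have : 0 ≤ ∑ i ∈ s, x i ^ 2 := Finset.sum_nonneg fun _ _ => sq_nonneg _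
    linarith
  have hmgf : mgf (fun x : ι → ℝ => -∑ i ∈ s, x i ^ 2) P 1 = (√3)⁻¹ ^ s.card := by
    rw [mgf, hf, integral_fintype_prod_eq_prod
      (f := fun (i : ι) (y : ℝ) => if i ∈ s then Real.exp (-y ^ 2) else 1)]
    have : ∀ i : ι, ∫ y, (if i ∈ s then Real.exp (-y ^ 2) else 1) ∂(gaussianReal 0 1) =
        if i ∈ s then (√3)⁻¹ else 1 := by
      intro i
      split_ifs
      · exact hG
      · simp
    simp_rw [this]
    simp [Finset.prod_ite_mem]
  have h3 : (√3)⁻¹ ≤ Real.exp (-(1 / 2)) := by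
    rw [Real.exp_neg]
    gcongr
    refine Real.le_sqrt_of_sq_le ?_
    rw [← Real.exp_nat_mul]
    norm_num
    linarith [Real.exp_one_lt_d9]
  calc P.real {x | ∑ i ∈ s, x i ^ 2 < (s.card : ℝ) / 4}
      ≤ P.real {x | -(s.card : ℝ) / 4 ≤ -∑ i ∈ s, x i ^ 2} := by
        refine measureReal_mono fun x hx => ?_
        simp only [mem_ofPred_eq] at hx ⊢
        linarith
    _ ≤ Real.exp (-1 * (-(s.card : ℝ) / 4)) * mgf (fun x : ι → ℝ => -∑ i ∈ s, x i ^ 2) P 1 :=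
        measure_ge_le_exp_mul_mgf _ zero_le_one hint
    _ ≤ Real.exp (-1 * (-(s.card : ℝ) / 4)) * Real.exp (-(1 / 2)) ^ s.card := by
        rw [hmgf]
        gcongr
    _ = Real.exp (-(s.card : ℝ) / 4) := by
        rw [← Real.exp_nat_mul, ← Real.exp_add]
        congr 1
        ring

/-- A standard Gaussian vector of `ℝ^H` is unlikely to be at distance less than `√((H - n) / 4)` from
a given subspace of dimension at most `n`. -/
lemma stdGaussian_dist_lt {H n : ℕ} (V : Submodule ℝ (EuclideanSpace ℝ (Fin H)))
    (hn : Module.finrank ℝ V ≤ n) {r : ℝ} (hr : r ^ 2 ≤ ((H : ℝ) - n) / 4) :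
    stdGaussian (EuclideanSpace ℝ (Fin H)) {g | ∃ v ∈ V, ‖g - v‖ < r} ≤
      ENNReal.ofReal (Real.exp (-((H : ℝ) - n) / 4)) := by
  classical
  -- In an orthonormal basis `b` that extends one of `Vᗮ`, the squared distance to `V` is at least the
  -- sum of the squares of the coordinates along `Vᗮ`, indexed by `s`.
  set b₀ := stdOrthonormalBasis ℝ Vᗮ
  have ho : Orthonormal ℝ (fun i => (b₀ i : EuclideanSpace ℝ (Fin H))) :=
    b₀.orthonormal.comp_linearIsometry Vᗮ.subtypeₗᵢ
  obtain ⟨u, b, hu, hb⟩ := ho.toSubtypeRange.exists_orthonormalBasis_extension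
  set s : Finset u := Finset.univ.filter fun i => (i : EuclideanSpace ℝ (Fin H)) ∈
    range (fun i => (b₀ i : EuclideanSpace ℝ (Fin H)))
  have hs : (H : ℝ) - n ≤ s.card := by
    have h1 : Module.finrank ℝ Vᗮ ≤ s.card := by
      have : Fintype.card (Fin (Module.finrank ℝ Vᗮ)) ≤ s.card := by
        rw [← Finset.card_univ]
        refine Finset.card_le_card_of_injOn (fun i => ⟨(b₀ i : _), hu ⟨i, rfl⟩⟩) ?_ ?_
        · intro i _
          simp [s]
        · intro i _ j _ hij
          exact ho.linearIndependent.injective (by simpa using hij)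
      simpa using this
    have h2 := V.finrank_add_finrank_orthogonal
    rw [finrank_euclideanSpace_fin] at h2
    have : H ≤ n + s.card := by omega
    have : (H : ℝ) ≤ n + s.card := by exact_mod_cast this
    linarith
  have hmeas : MeasurableSet {g : EuclideanSpace ℝ (Fin H) | ∃ v ∈ V, ‖g - v‖ < r} := by
    have : {g : EuclideanSpace ℝ (Fin H) | ∃ v ∈ V, ‖g - v‖ < r} =
        ⋃ v ∈ V, {g | ‖g - v‖ < r} := by
      ext; simp
    rw [this]
    exact (isOpen_biUnion fun v _ =>
      isOpen_lt (by fun_prop) (by fun_prop)).measurableSet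
  rw [stdGaussian_eq_map_pi_orthonormalBasis b, Measure.map_apply (by fun_prop) hmeas,
    ← ofReal_measureReal]
  refine ENNReal.ofReal_le_ofReal ?_
  calc _ ≤ (Measure.pi fun _ : u => gaussianReal 0 1).real
        {x | ∑ i ∈ s, x i ^ 2 < (s.card : ℝ) / 4} := by
        refine measureReal_mono ?_
        rintro x ⟨v, hv, hxv⟩
        simp only [mem_ofPred_eq]
        have h1 : ∑ i ∈ s, x i ^ 2 ≤ ‖∑ i, x i • b i - v‖ ^ 2 := by
          rw [← b.sum_sq_inner_right]
          calc ∑ i ∈ s, x i ^ 2 = ∑ i ∈ s, inner ℝ (b i) (∑ i, x i • b i - v) ^ 2 := by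
                refine Finset.sum_congr rfl fun i hi => ?_
                have : inner ℝ (b i) v = 0 := by
                  obtain ⟨j, hj⟩ := (Finset.mem_filter.1 hi).2
                  rw [hb, ← hj]
                  exact (Submodule.mem_orthogonal' _ _).1 (b₀ j).2 v hv
                rw [inner_sub_right, this, b.orthonormal.inner_right_fintype]
                simp
            _ ≤ _ := Finset.sum_le_sum_of_subset_of_nonneg (Finset.subset_univ _)
                fun _ _ _ => sq_nonneg _
        have h2 : ‖∑ i, x i • b i - v‖ ^ 2 < r ^ 2 := by gcongr
        linarith
    _ ≤ Real.exp (-(s.card : ℝ) / 4) := pi_gaussianReal_sum_sq_lt s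
    _ ≤ _ := by
        gcongr

/-- If `g` is a standard Gaussian vector independent of `n` vectors, then it is unlikely to be close
to a linear combination of them. -/
lemma measure_dist_span_lt {Ω : Type*} [MeasurableSpace Ω] {μ : Measure Ω} [IsProbabilityMeasure μ]
    {H : ℕ} {J : Type*} [Fintype J] {q : Ω → J → EuclideanSpace ℝ (Fin H)}
    {g : Ω → EuclideanSpace ℝ (Fin H)} (hq : Measurable q) (hg : Measurable g)
    (hlaw : μ.map g = stdGaussian (EuclideanSpace ℝ (Fin H))) (h : IndepFun q g μ) {r : ℝ}
    (hr : r ^ 2 ≤ ((H : ℝ) - Fintype.card J) / 4) :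
    μ {ω | ∃ c : J → ℝ, ‖g ω - ∑ j, c j • q ω j‖ < r} ≤
      ENNReal.ofReal (Real.exp (-((H : ℝ) - Fintype.card J) / 4)) := by
  refine measure_le_of_indepFun hq hg h
    (S := {a | ∃ c : J → ℝ, ‖a.2 - ∑ j, c j • a.1 j‖ < r}) ?_ fun a => ?_
  · have : {a : (J → EuclideanSpace ℝ (Fin H)) × EuclideanSpace ℝ (Fin H) |
        ∃ c : J → ℝ, ‖a.2 - ∑ j, c j • a.1 j‖ < r} =
        ⋃ c : J → ℝ, {a | ‖a.2 - ∑ j, c j • a.1 j‖ < r} := by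
      ext; simp
    rw [this]
    exact (isOpen_iUnion fun c => isOpen_lt (by fun_prop) (by fun_prop)).measurableSet
  · rw [hlaw]
    refine le_trans (measure_mono ?_)
      (stdGaussian_dist_lt (Submodule.span ℝ (range a)) (finrank_range_le_card a) hr)
    rintro g ⟨c, hc⟩
    exact ⟨_, Submodule.sum_mem _ fun j _ => Submodule.smul_mem _ _
      (Submodule.subset_span ⟨j, rfl⟩), hc⟩

end SmallBall

/-! ### Projection of a sub-Gaussian vector onto a subspace -/

section Noise

variable {Ω : Type*} [MeasurableSpace Ω] {μ : Measure Ω}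

lemma hasSubgaussianMGF_const_mul {X : Ω → ℝ} {c : ℝ≥0} (h : HasSubgaussianMGF X c μ) (r : ℝ) :
    HasSubgaussianMGF (fun ω => r * X ω) (‖r‖₊ ^ 2 * c) μ := by
  convert h.const_mul r using 2
  ext
  simp only [NNReal.coe_mul, NNReal.coe_pow, coe_nnnorm, Real.norm_eq_abs, sq_abs]
  rfl

/-- A vector with independent sub-Gaussian coordinates has a small projection onto a given subspace
of dimension at most `n`. -/
lemma subgaussian_inner_subspace [IsProbabilityMeasure μ] {H n : ℕ}
    (V : Submodule ℝ (EuclideanSpace ℝ (Fin H))) (hn : Module.finrank ℝ V ≤ n)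
    {w : Ω → EuclideanSpace ℝ (Fin H)} {c : ℝ≥0}
    (hi : iIndepFun (fun l ω => w ω l) μ) (hw : ∀ l, HasSubgaussianMGF (fun ω => w ω l) c μ)
    {t : ℝ} (ht : 0 ≤ t) :
    μ {ω | ∃ v ∈ V, n * t * ‖v‖ < inner ℝ v (w ω)} ≤
      ENNReal.ofReal (2 * n * Real.exp (-t ^ 2 / (2 * c))) := by
  set b := stdOrthonormalBasis ℝ V
  have hsub (k) : HasSubgaussianMGF (fun ω => inner ℝ (b k : EuclideanSpace ℝ (Fin H)) (w ω)) c μ := by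
    have h1 : iIndepFun (fun l ω => (b k : EuclideanSpace ℝ (Fin H)) l * w ω l) μ :=
      hi.comp (fun l x => (b k : EuclideanSpace ℝ (Fin H)) l * x) (fun l => by fun_prop)
    have h2 := HasSubgaussianMGF.sum_of_iIndepFun h1 (s := Finset.univ)
      (fun l _ => hasSubgaussianMGF_const_mul (hw l) _)
    convert h2 using 1
    · ext ω
      simp [PiLp.inner_apply, mul_comm]
    · rw [← Finset.sum_mul]
      have : ∑ l, ‖(b k : EuclideanSpace ℝ (Fin H)) l‖₊ ^ 2 = 1 := by
        ext
        have := EuclideanSpace.norm_sq_eq (b k : EuclideanSpace ℝ (Fin H))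
        rw [show ‖(b k : EuclideanSpace ℝ (Fin H))‖ = 1 from b.orthonormal.1 k] at this
        push_cast
        simpa using this.symm
      rw [this, one_mul]
  -- A long projection has a long coordinate in the orthonormal basis `b` of `V`.
  have hcov : {ω | ∃ v ∈ V, n * t * ‖v‖ < inner ℝ v (w ω)} ⊆
      ⋃ k, ({ω | t ≤ inner ℝ (b k : EuclideanSpace ℝ (Fin H)) (w ω)} ∪
        {ω | t ≤ -inner ℝ (b k : EuclideanSpace ℝ (Fin H)) (w ω)}) := by
    rintro ω ⟨v, hv, hlt⟩
    by_contra hcon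
    simp only [mem_iUnion, mem_union, mem_ofPred_eq, not_exists, not_or, not_le] at hcon
    have hv' : v = ∑ k, inner ℝ (b k) (⟨v, hv⟩ : V) • (b k : EuclideanSpace ℝ (Fin H)) := by
      have := congrArg Subtype.val (b.sum_repr' ⟨v, hv⟩)
      simpa using this.symm
    have : inner ℝ v (w ω) ≤ n * t * ‖v‖ := by
      rw [hv', sum_inner, ← hv']
      calc _ ≤ ∑ k : Fin (Module.finrank ℝ V), t * ‖v‖ := by
            refine Finset.sum_le_sum fun k _ => ?_
            rw [real_inner_smul_left]
            calc _ ≤ |inner ℝ (b k) (⟨v, hv⟩ : V)| *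
                    |inner ℝ (b k : EuclideanSpace ℝ (Fin H)) (w ω)| := by
                  rw [← abs_mul]; exact le_abs_self _
              _ ≤ ‖v‖ * t := by
                  gcongr
                  · simpa [b.orthonormal.1 k] using abs_real_inner_le_norm (b k) (⟨v, hv⟩ : V)
                  · exact abs_le.2 ⟨by linarith [(hcon k).2], (hcon k).1.le⟩
              _ = _ := mul_comm _ _
        _ = Module.finrank ℝ V * (t * ‖v‖) := by simp
        _ ≤ n * (t * ‖v‖) := by gcongr
        _ = _ := by ring
    linarith
  calc _ ≤ _ := measure_mono hcov
    _ ≤ ∑ k, μ _ := measure_iUnion_fintype_le _ _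
    _ ≤ ∑ k : Fin (Module.finrank ℝ V), ENNReal.ofReal (2 * Real.exp (-t ^ 2 / (2 * c))) := by
        refine Finset.sum_le_sum fun k _ => (measure_union_le _ _).trans ?_
        rw [two_mul, ENNReal.ofReal_add (by positivity) (by positivity)]
        gcongr
        · rw [← ofReal_measureReal]
          exact ENNReal.ofReal_le_ofReal ((hsub k).measure_ge_le ht)
        · rw [← ofReal_measureReal]
          exact ENNReal.ofReal_le_ofReal ((hsub k).neg.measure_ge_le ht)
    _ ≤ n * ENNReal.ofReal (2 * Real.exp (-t ^ 2 / (2 * c))) := by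
        simp only [Finset.sum_const, Finset.card_univ, Fintype.card_fin, nsmul_eq_mul]
        gcongr
    _ = _ := by
        rw [← ENNReal.ofReal_natCast, ← ENNReal.ofReal_mul (by positivity)]
        congr 1
        ring

/-- A vector with independent sub-Gaussian coordinates has a small projection onto the span of `n`
random vectors that are independent of it, whatever the law of these vectors is. -/
lemma measure_inner_span_gt [IsProbabilityMeasure μ] {H : ℕ} {J : Type*} [Fintype J]
    {z : Ω → J → EuclideanSpace ℝ (Fin H)} {w : Ω → EuclideanSpace ℝ (Fin H)} (hz : Measurable z)
    (hw : Measurable w) (h : IndepFun z w μ) {c : ℝ≥0} (hi : iIndepFun (fun l ω => w ω l) μ)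
    (hsub : ∀ l, HasSubgaussianMGF (fun ω => w ω l) c μ) {t : ℝ} (ht : 0 ≤ t) :
    μ {ω | ∃ a : J → ℝ, Fintype.card J * t * ‖∑ j, a j • z ω j‖ <
        inner ℝ (∑ j, a j • z ω j) (w ω)} ≤
      ENNReal.ofReal (2 * Fintype.card J * Real.exp (-t ^ 2 / (2 * c))) := by
  have hop (a : J → ℝ) : IsOpen {q : (J → EuclideanSpace ℝ (Fin H)) × EuclideanSpace ℝ (Fin H) |
      Fintype.card J * t * ‖∑ j, a j • q.1 j‖ < inner ℝ (∑ j, a j • q.1 j) q.2} :=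
    isOpen_lt (by fun_prop) (by fun_prop)
  have hS : IsOpen {q : (J → EuclideanSpace ℝ (Fin H)) × EuclideanSpace ℝ (Fin H) |
      ∃ a : J → ℝ, Fintype.card J * t * ‖∑ j, a j • q.1 j‖ <
        inner ℝ (∑ j, a j • q.1 j) q.2} := by
    simp only [ofPred_exists]
    exact isOpen_iUnion hop
  refine measure_le_of_indepFun hz hw h hS.measurableSet fun z₀ => ?_
  rw [Measure.map_apply hw]
  · refine le_trans (measure_mono ?_) (subgaussian_inner_subspace
      (Submodule.span ℝ (range z₀)) (finrank_range_le_card z₀) hi hsub ht)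
    rintro ω ⟨a, ha⟩
    exact ⟨_, Submodule.sum_mem _ fun j _ => Submodule.smul_mem _ _
      (Submodule.subset_span ⟨j, rfl⟩), ha⟩
  · exact (hS.preimage (by fun_prop : Continuous fun b => (z₀, b))).measurableSet

end Noise

/-! ### Exponential and logarithm series in a Banach algebra -/

section BanachAlgebra

variable {𝔸 : Type*} [NormedRing 𝔸]

lemma norm_log_coeff_smul_le (k : ℕ) [NormedAlgebra ℝ 𝔸] (Z : 𝔸) :
    ‖((-1 : ℝ) ^ k / (k + 1)) • Z‖ ≤ ‖Z‖ / (k + 1) := by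
  rw [norm_smul, norm_div, norm_pow, norm_neg, norm_one, one_pow, Real.norm_of_nonneg (by positivity),
    one_div_mul_eq_div]

/-- Derivative of a power of `exp (t X) - 1`; all factors commute. -/
lemma hasDerivAt_exp_sub_one_pow [NormedAlgebra ℝ 𝔸] [CompleteSpace 𝔸] (X : 𝔸) (t : ℝ) (k : ℕ) :
    HasDerivAt (fun t : ℝ => (NormedSpace.exp (t • X) - 1) ^ (k + 1))
      (((k : ℝ) + 1) • ((NormedSpace.exp (t • X) - 1) ^ k * (NormedSpace.exp (t • X) * X))) t := by
  have h1 : HasDerivAt (fun t : ℝ => NormedSpace.exp (t • X) - 1) (NormedSpace.exp (t • X) * X) t :=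
    (hasDerivAt_exp_smul_const X t).sub_const 1
  have hc : Commute (NormedSpace.exp (t • X) - 1) (NormedSpace.exp (t • X) * X) := by
    have h2 : Commute (NormedSpace.exp (t • X)) X :=
      ((Commute.refl X).smul_left t).exp_left
    exact (((Commute.refl _).mul_right h2).sub_left (Commute.one_left _))
  induction k with
  | zero => simpa using h1
  | succ k ih =>
    have h3 := ih.mul h1
    have hf : (fun t : ℝ => (NormedSpace.exp (t • X) - 1) ^ (k + 1 + 1)) =
        (fun t : ℝ => (NormedSpace.exp (t • X) - 1) ^ (k + 1)) *
          fun t : ℝ => NormedSpace.exp (t • X) - 1 := by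
      ext t
      exact pow_succ _ _
    rw [hf]
    refine h3.congr_deriv ?_
    rw [smul_mul_assoc, mul_assoc, ← hc.eq, ← mul_assoc, ← pow_succ]
    push_cast
    rw [add_smul (_ + _) (1 : ℝ), one_smul]

variable [NormOneClass 𝔸]

lemma norm_pow_sub_pow_le {r : ℝ} {X Y : 𝔸} (hX : ‖X‖ ≤ r) (hY : ‖Y‖ ≤ r) (k : ℕ) :
    ‖X ^ (k + 1) - Y ^ (k + 1)‖ ≤ (k + 1) * r ^ k * ‖X - Y‖ := by
  have hr : 0 ≤ r := (norm_nonneg X).trans hX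
  induction k with
  | zero => simp
  | succ k ih =>
    have : X ^ (k + 1 + 1) - Y ^ (k + 1 + 1) =
        X * (X ^ (k + 1) - Y ^ (k + 1)) + (X - Y) * Y ^ (k + 1) := by
      rw [pow_succ' X (k + 1), pow_succ' Y (k + 1)]
      noncomm_ring
    rw [this]
    calc _ ≤ ‖X‖ * ‖X ^ (k + 1) - Y ^ (k + 1)‖ + ‖X - Y‖ * ‖Y ^ (k + 1)‖ :=
          (norm_add_le _ _).trans (add_le_add (norm_mul_le _ _) (norm_mul_le _ _))
      _ ≤ r * ((k + 1) * r ^ k * ‖X - Y‖) + ‖X - Y‖ * r ^ (k + 1) := by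
          gcongr
          exact (norm_pow_le _ _).trans (by gcongr)
      _ = _ := by push_cast; ring

variable [NormedAlgebra ℝ 𝔸]

lemma norm_exp_le {r : ℝ} {X : 𝔸} (hX : ‖X‖ ≤ r) : ‖NormedSpace.exp X‖ ≤ Real.exp r := by
  have hs : HasSum (fun k : ℕ => (k.factorial : ℝ)⁻¹ • r ^ k) (Real.exp r) := by
    rw [Real.exp_eq_exp_ℝ]
    exact NormedSpace.exp_series_hasSum_exp' r
  rw [NormedSpace.exp_eq_tsum ℝ]
  refine tsum_of_norm_bounded hs fun k => ?_
  rw [norm_smul, norm_inv, Real.norm_natCast, smul_eq_mul]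
  gcongr
  exact (norm_pow_le _ _).trans (by gcongr)

variable [CompleteSpace 𝔸]

lemma summable_log_series {r : ℝ} (hr : r < 1) {M : 𝔸} (hM : ‖M - 1‖ ≤ r) :
    Summable fun k : ℕ => ((-1 : ℝ) ^ k / (k + 1)) • (M - 1) ^ (k + 1) := by
  have hr0 : 0 ≤ r := (norm_nonneg _).trans hM
  refine Summable.of_norm_bounded ((summable_geometric_of_lt_one hr0 hr).mul_left r) fun k => ?_
  refine (norm_log_coeff_smul_le _ _).trans ?_
  calc ‖(M - 1) ^ (k + 1)‖ / (k + 1) ≤ ‖(M - 1) ^ (k + 1)‖ :=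
        div_le_self (norm_nonneg _) (by linarith [(Nat.cast_nonneg k : (0 : ℝ) ≤ k)])
    _ ≤ r ^ (k + 1) := (norm_pow_le _ _).trans (by gcongr)
    _ = r * r ^ k := pow_succ' _ _

lemma norm_log_series_sub_le {r : ℝ} (hr : r < 1) {M M' : 𝔸} (hM : ‖M - 1‖ ≤ r)
    (hM' : ‖M' - 1‖ ≤ r) :
    ‖(∑' k : ℕ, ((-1 : ℝ) ^ k / (k + 1)) • (M - 1) ^ (k + 1)) -
      ∑' k : ℕ, ((-1 : ℝ) ^ k / (k + 1)) • (M' - 1) ^ (k + 1)‖ ≤ (1 - r)⁻¹ * ‖M - M'‖ := by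
  have hr0 : 0 ≤ r := (norm_nonneg _).trans hM
  rw [← (summable_log_series hr hM).tsum_sub (summable_log_series hr hM')]
  refine tsum_of_norm_bounded ((hasSum_geometric_of_lt_one hr0 hr).mul_right _) fun k => ?_
  rw [← smul_sub]
  refine (norm_log_coeff_smul_le _ _).trans ?_
  have := norm_pow_sub_pow_le hM hM' k
  rw [sub_sub_sub_cancel_right] at this
  rw [div_le_iff₀ (by positivity)]
  linarith

lemma norm_exp_sub_exp_le {r : ℝ} {X Y : 𝔸} (hX : ‖X‖ ≤ r) (hY : ‖Y‖ ≤ r) :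
    ‖NormedSpace.exp X - NormedSpace.exp Y‖ ≤ Real.exp r * ‖X - Y‖ := by
  rw [NormedSpace.exp_eq_tsum ℝ]
  have sX := NormedSpace.expSeries_summable' (𝕂 := ℝ) X
  have sY := NormedSpace.expSeries_summable' (𝕂 := ℝ) Y
  simp only
  rw [sX.tsum_eq_zero_add, sY.tsum_eq_zero_add]
  simp only [pow_zero, add_sub_add_left_eq_sub]
  rw [← ((summable_nat_add_iff 1).2 sX).tsum_sub ((summable_nat_add_iff 1).2 sY)]
  have hs : HasSum (fun k : ℕ => (k.factorial : ℝ)⁻¹ • r ^ k) (Real.exp r) := by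
    rw [Real.exp_eq_exp_ℝ]
    exact NormedSpace.exp_series_hasSum_exp' r
  refine tsum_of_norm_bounded (hs.mul_right _) fun k => ?_
  rw [← smul_sub, norm_smul, norm_inv, Real.norm_natCast, Nat.factorial_succ, smul_eq_mul]
  calc _ ≤ (((k + 1) * k.factorial : ℕ) : ℝ)⁻¹ * ((k + 1) * r ^ k * ‖X - Y‖) := by
        gcongr
        exact norm_pow_sub_pow_le hX hY k
    _ = _ := by
        push_cast
        field_simp

lemma norm_exp_sub_one_le {r : ℝ} {X : 𝔸} (hX : ‖X‖ ≤ r) :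
    ‖NormedSpace.exp X - 1‖ ≤ Real.exp r * r := by
  have hr : 0 ≤ r := (norm_nonneg _).trans hX
  have := norm_exp_sub_exp_le hX (Y := 0) (by simpa)
  rw [NormedSpace.exp_zero, sub_zero] at this
  exact this.trans (by gcongr)

/-- The logarithm series inverts the exponential near `0`: along `t ↦ exp (t X)`, the series has the
constant derivative `X`. -/
lemma log_series_exp {X : 𝔸} (hX : ‖X‖ ≤ 1 / 15) :
    ∑' k : ℕ, ((-1 : ℝ) ^ k / (k + 1)) • (NormedSpace.exp X - 1) ^ (k + 1) = X := by
  set E : ℝ → 𝔸 := fun t => NormedSpace.exp (t • X)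
  have hE : ∀ t ∈ Ioo (-2 : ℝ) 2, ‖E t - 1‖ ≤ 1 / 5 := by
    intro t ht
    have : ‖t • X‖ ≤ 2 / 15 := by
      rw [norm_smul]
      calc ‖t‖ * ‖X‖ ≤ 2 * (1 / 15) := by
            gcongr
            exact abs_le.2 ⟨ht.1.le, ht.2.le⟩
        _ = _ := by norm_num
    refine (norm_exp_sub_one_le this).trans ?_
    have : Real.exp (2 / 15) ≤ 1 / (1 - 2 / 15) :=
      Real.exp_bound_div_one_sub_of_interval (by norm_num) (by norm_num)
    linarith
  have hE2 : ∀ t ∈ Ioo (-2 : ℝ) 2, ‖E t‖ ≤ 2 := by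
    intro t ht
    calc ‖E t‖ = ‖(E t - 1) + 1‖ := by simp
      _ ≤ ‖E t - 1‖ + 1 := (norm_add_le _ _).trans (by simp)
      _ ≤ 2 := by linarith [hE t ht]
  have hderiv : ∀ t ∈ Ioo (-2 : ℝ) 2, HasDerivAt
      (fun t => ∑' k : ℕ, ((-1 : ℝ) ^ k / (k + 1)) • (E t - 1) ^ (k + 1)) X t := by
    intro t ht
    have key := hasDerivAt_tsum_of_isPreconnected
      (u := fun k : ℕ => (1 / 5 : ℝ) ^ k * (2 * (1 / 15)))
      (g := fun (k : ℕ) t => ((-1 : ℝ) ^ k / (k + 1)) • (E t - 1) ^ (k + 1))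
      (g' := fun (k : ℕ) t => ((-1 : ℝ) ^ k / (k + 1)) •
        (((k : ℝ) + 1) • ((E t - 1) ^ k * (E t * X))))
      ((summable_geometric_of_lt_one (by norm_num) (by norm_num)).mul_right _)
      isOpen_Ioo isPreconnected_Ioo
      (fun k y _ => (hasDerivAt_exp_sub_one_pow X y k).fun_const_smul _) ?_ ht
      (summable_log_series (by norm_num) (hE t ht)) ht
    · refine key.congr_deriv ?_
      have h1 : ∀ k : ℕ, ((-1 : ℝ) ^ k / (k + 1)) •
          (((k : ℝ) + 1) • ((E t - 1) ^ k * (E t * X))) = (1 - E t) ^ k * (E t * X) := by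
        intro k
        rw [smul_smul, div_mul_cancel₀ _ (by positivity), ← smul_mul_assoc, ← neg_sub (E t) 1,
          neg_pow (E t - 1), Algebra.smul_def]
        simp
      simp_rw [h1]
      have hs : Summable fun k : ℕ => (1 - E t) ^ k :=
        summable_geometric_of_norm_lt_one (by rw [norm_sub_rev]; linarith [hE t ht])
      -- The derivatives sum to `(∑ (1 - E)ᵏ) E X = E⁻¹ E X`.
      rw [hs.tsum_mul_right, ← mul_assoc]
      have := geom_series_mul_neg (1 - E t) (by rw [norm_sub_rev]; linarith [hE t ht])
      rw [sub_sub_cancel] at this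
      rw [this, one_mul]
    · intro k y hy
      rw [smul_smul, div_mul_cancel₀ _ (by positivity), norm_smul, norm_pow, norm_neg, norm_one,
        one_pow, one_mul]
      calc _ ≤ ‖(E y - 1) ^ k‖ * (‖E y‖ * ‖X‖) :=
            (norm_mul_le _ _).trans (by gcongr; exact norm_mul_le _ _)
        _ ≤ _ := by
            gcongr
            · exact (norm_pow_le _ _).trans (by gcongr; exact hE y hy)
            · exact hE2 y hy
  have hsub : Icc (0 : ℝ) 1 ⊆ Ioo (-2 : ℝ) 2 := fun x hx => ⟨by linarith [hx.1], by linarith [hx.2]⟩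
  have hconst := constant_of_has_deriv_right_zero (a := (0 : ℝ)) (b := 1)
    (f := fun t => (∑' k : ℕ, ((-1 : ℝ) ^ k / (k + 1)) • (E t - 1) ^ (k + 1)) - t • X)
    (fun t ht => ((hderiv t (hsub ht)).continuousAt.sub (by fun_prop)).continuousWithinAt)
    (fun t ht => by
      have := ((hderiv t (hsub ⟨ht.1, ht.2.le⟩)).fun_sub
        ((hasDerivAt_id t).smul_const X)).hasDerivWithinAt (s := Ici t)
      simpa using this)
    1 (by simp)
  simp only [E, one_smul, zero_smul, NormedSpace.exp_zero, sub_self, ne_eq, Nat.succ_ne_zero,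
    not_false_eq_true, zero_pow, smul_zero, tsum_zero] at hconst
  exact sub_eq_zero.1 (by simpa using hconst)

end BanachAlgebra

/-! ### Stability of the recovery map -/

section Recovery

variable {d p : ℕ}

lemma norm_matrix_exp_sub_exp_le [NeZero d] {r : ℝ} {X Y : Matrix (Fin d) (Fin d) ℝ} (hX : ‖X‖ ≤ r)
    (hY : ‖Y‖ ≤ r) : ‖NormedSpace.exp X - NormedSpace.exp Y‖ ≤ Real.exp r * ‖X - Y‖ :=
  norm_exp_sub_exp_le hX hY

lemma continuous_exp_smul (A : Matrix (Fin d) (Fin d) ℝ) :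
    Continuous fun t : ℝ => NormedSpace.exp (t • A) :=
  continuous_iff_continuousAt.2 fun t => (hasDerivAt_exp_smul_const A t).continuousAt

lemma norm_expIntegral_sub_le [NeZero d] {h r : ℝ} (hh : 0 ≤ h) {A A' : Matrix (Fin d) (Fin d) ℝ}
    (hA : h * ‖A‖ ≤ r) (hA' : h * ‖A'‖ ≤ r) :
    ‖expIntegral h A - expIntegral h A'‖ ≤ h * (Real.exp r * (h * ‖A - A'‖)) := by
  rw [expIntegral, expIntegral, ← intervalIntegral.integral_sub
    ((continuous_exp_smul A).intervalIntegrable _ _)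
    ((continuous_exp_smul A').intervalIntegrable _ _)]
  have hb : ∀ t ∈ uIoc 0 h, ‖NormedSpace.exp (t • A) - NormedSpace.exp (t • A')‖ ≤
      Real.exp r * (h * ‖A - A'‖) := by
    intro t ht
    rw [uIoc_of_le hh] at ht
    have hs (Z : Matrix (Fin d) (Fin d) ℝ) : ‖t • Z‖ ≤ h * ‖Z‖ := by
      rw [norm_smul, Real.norm_of_nonneg ht.1.le]
      gcongr
      exact ht.2
    refine (norm_matrix_exp_sub_exp_le ((hs A).trans hA) ((hs A').trans hA')).trans ?_
    rw [← smul_sub]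
    gcongr
    exact hs _
  have := intervalIntegral.norm_integral_le_of_norm_le_const hb
  rwa [sub_zero, abs_of_nonneg hh, mul_comm] at this

lemma expIntegral_zero (h : ℝ) : expIntegral h (0 : Matrix (Fin d) (Fin d) ℝ) = h • 1 := by
  simp [expIntegral]

lemma norm_expIntegral_sub_smul_one_le [NeZero d] {h : ℝ} (hh : 0 ≤ h)
    {A : Matrix (Fin d) (Fin d) ℝ} (hA : h * ‖A‖ ≤ 1 / 10) :
    ‖expIntegral h A - h • 1‖ ≤ h / 4 := by
  have h1 := norm_expIntegral_sub_le hh hA (A' := 0) (by simp)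
  rw [expIntegral_zero, sub_zero] at h1
  have h2 : Real.exp (1 / 10) ≤ 1 / (1 - 1 / 10) :=
    Real.exp_bound_div_one_sub_of_interval (by norm_num) (by norm_num)
  refine h1.trans ?_
  calc h * (Real.exp (1 / 10) * (h * ‖A‖)) ≤ h * (1 / (1 - 1 / 10) * (1 / 10)) := by gcongr
    _ ≤ h / 4 := by linarith

/-- A matrix close to `h • 1` is invertible, and its inverse is controlled. -/
lemma isUnit_of_norm_sub_smul_one_le [NeZero d] {h : ℝ} (hh : 0 < h)
    {Z : Matrix (Fin d) (Fin d) ℝ} (hZ : ‖Z - h • 1‖ ≤ h / 4) :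
    IsUnit Z ∧ ∀ {q : ℕ} (Y : Matrix (Fin d) (Fin q) ℝ), ‖Y‖ ≤ 2 / h * ‖Z * Y‖ := by
  constructor
  · have h1 : ‖1 - h⁻¹ • Z‖ < 1 := by
      have : 1 - h⁻¹ • Z = -(h⁻¹ • (Z - h • 1)) := by
        rw [smul_sub, smul_smul, inv_mul_cancel₀ hh.ne', one_smul, neg_sub]
      rw [this, norm_neg, norm_smul, norm_inv, Real.norm_of_nonneg hh.le]
      calc h⁻¹ * ‖Z - h • 1‖ ≤ h⁻¹ * (h / 4) := by gcongr
        _ < 1 := by field_simp; norm_num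
    have h2 := isUnit_one_sub_of_norm_lt_one h1
    rw [sub_sub_cancel] at h2
    have h3 : Z = algebraMap ℝ _ h * (h⁻¹ • Z) := by
      rw [← Algebra.smul_def, smul_smul, mul_inv_cancel₀ hh.ne', one_smul]
    rw [h3]
    exact ((isUnit_iff_ne_zero.2 hh.ne').map (algebraMap ℝ (Matrix (Fin d) (Fin d) ℝ))).mul h2
  · intro q Y
    -- `h Y = Z Y - (Z - h) Y`, and the last term is absorbed.
    have h1 : h • Y = Z * Y - (Z - h • 1) * Y := by
      rw [Matrix.sub_mul, Matrix.smul_mul, Matrix.one_mul, sub_sub_cancel]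
    have h2 : h * ‖Y‖ ≤ ‖Z * Y‖ + h / 4 * ‖Y‖ := by
      calc h * ‖Y‖ = ‖h • Y‖ := by rw [norm_smul, Real.norm_of_nonneg hh.le]
        _ ≤ ‖Z * Y‖ + ‖(Z - h • 1) * Y‖ := by rw [h1]; exact norm_sub_le _ _
        _ ≤ _ := by
          gcongr
          exact (Matrix.l2_opNorm_mul _ _).trans (by gcongr)
    rw [div_mul_eq_mul_div, le_div_iff₀ hh]
    nlinarith [norm_nonneg (Z * Y), mul_nonneg hh.le (norm_nonneg Y)]

/-- If `M` and `N` are close to the discrete-time system matrices `exp (h A)` and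
`(∫₀ʰ exp (t A) dt) B`, then the recovered matrices are close to `A` and `B`. -/
theorem recover_stable [NeZero d] {h : ℝ} (hh : 0 < h) {A M : Matrix (Fin d) (Fin d) ℝ}
    {B N : Matrix (Fin d) (Fin p) ℝ} (hA : h * ‖A‖ ≤ 1 / 15) {ε η : ℝ} (hε : ε ≤ 1 / 100)
    (hM : ‖M - NormedSpace.exp (h • A)‖ ≤ ε) (hN : ‖N - expIntegral h A * B‖ ≤ η) :
    Summable (logTerm M) ∧ IsUnit (expIntegral h (recoverA h M)) ∧
      ‖recoverA h M - A‖ ≤ 2 * ε / h ∧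
      ‖recoverB h M N - B‖ ≤ 2 / h * (η + 4 * h * ε * ‖B‖) := by
  have hε0 : 0 ≤ ε := (norm_nonneg _).trans hM
  have hA' : ‖h • A‖ ≤ 1 / 15 := by rwa [norm_smul, Real.norm_of_nonneg hh.le]
  have he : ‖NormedSpace.exp (h • A) - 1‖ ≤ 1 / 10 := by
    refine (norm_exp_sub_one_le hA').trans ?_
    have : Real.exp (1 / 15) ≤ 1 / (1 - 1 / 15) :=
      Real.exp_bound_div_one_sub_of_interval (by norm_num) (by norm_num)
    linarith
  have hM1 : ‖M - 1‖ ≤ 1 / 5 := by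
    calc ‖M - 1‖ = ‖(M - NormedSpace.exp (h • A)) + (NormedSpace.exp (h • A) - 1)‖ := by
          rw [sub_add_sub_cancel]
      _ ≤ ε + 1 / 10 := (norm_add_le _ _).trans (add_le_add hM he)
      _ ≤ 1 / 5 := by linarith
  have hsum : Summable (logTerm M) := summable_log_series (by norm_num) hM1
  have hlog : ‖h • recoverA h M - h • A‖ ≤ 2 * ε := by
    have h1 := norm_log_series_sub_le (by norm_num) hM1 (he.trans (by norm_num))
    rw [log_series_exp hA'] at h1
    have h2 : h • recoverA h M = ∑' k, logTerm M k := by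
      rw [recoverA, smul_smul, mul_inv_cancel₀ hh.ne', one_smul]
    rw [h2]
    refine h1.trans ?_
    norm_num
    linarith
  have hlog' : h * ‖recoverA h M - A‖ ≤ 2 * ε := by
    rwa [← smul_sub, norm_smul, Real.norm_of_nonneg hh.le] at hlog
  have hAhat : h * ‖recoverA h M‖ ≤ 1 / 10 := by
    calc h * ‖recoverA h M‖ = h * ‖(recoverA h M - A) + A‖ := by rw [sub_add_cancel]
      _ ≤ h * (‖recoverA h M - A‖ + ‖A‖) := by gcongr; exact norm_add_le _ _
      _ ≤ 1 / 10 := by rw [mul_add]; linarith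
  obtain ⟨hunit, hinv⟩ := isUnit_of_norm_sub_smul_one_le hh
    (norm_expIntegral_sub_smul_one_le hh.le hAhat)
  refine ⟨hsum, hunit, ?_, ?_⟩
  · rw [le_div_iff₀ hh]
    linarith
  · have hdiff : ‖expIntegral h A - expIntegral h (recoverA h M)‖ ≤ 4 * h * ε := by
      refine (norm_expIntegral_sub_le hh.le (hA.trans (by norm_num)) hAhat).trans ?_
      have h2 : Real.exp (1 / 10) ≤ 1 / (1 - 1 / 10) :=
        Real.exp_bound_div_one_sub_of_interval (by norm_num) (by norm_num)
      rw [norm_sub_rev]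
      calc h * (Real.exp (1 / 10) * (h * ‖recoverA h M - A‖)) ≤ h * (2 * (2 * ε)) := by
            gcongr
            linarith
        _ = _ := by ring
    refine (hinv _).trans ?_
    gcongr
    have : expIntegral h (recoverA h M) * (recoverB h M N - B) = (N - expIntegral h A * B) +
        (expIntegral h A - expIntegral h (recoverA h M)) * B := by
      rw [Matrix.mul_sub, recoverB, ← Matrix.mul_assoc, Matrix.mul_nonsing_inv _
        ((Matrix.isUnit_iff_isUnit_det _).1 hunit), Matrix.one_mul, Matrix.sub_mul]
      abel
    rw [this]
    refine (norm_add_le _ _).trans (add_le_add hN ?_)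
    exact (Matrix.l2_opNorm_mul _ _).trans (by gcongr)

end Recovery

/-! ### Variation of constants -/

section VariationOfConstants

variable {E : Type*} [NormedAddCommGroup E] [NormedSpace ℝ E] [CompleteSpace E]

lemma clm_exp_smul_mul_exp_smul (L : E →L[ℝ] E) (a b : ℝ) :
    NormedSpace.exp (a • L) * NormedSpace.exp (b • L) = NormedSpace.exp ((a + b) • L) := by
  let _ : NormedAlgebra ℚ (E →L[ℝ] E) := NormedAlgebra.restrictScalars ℚ ℝ _
  rw [add_smul, NormedSpace.exp_add_of_commute]
  exact ((Commute.refl L).smul_left a).smul_right b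

lemma continuous_clm_exp_smul (L : E →L[ℝ] E) :
    Continuous fun t : ℝ => NormedSpace.exp (t • L) :=
  continuous_iff_continuousAt.2 fun t => (hasDerivAt_exp_smul_const L t).continuousAt

/-- The solution of the linear integral equation `z t = x₀ + ∫₀ᵗ (L z + f)`. -/
lemma variation_of_constants (L : E →L[ℝ] E) {z f : ℝ → E} {x₀ : E} {h : ℝ} (hh : 0 ≤ h)
    (hz : ContinuousOn z (Icc 0 h)) (hf : ContinuousOn f (Icc 0 h))
    (heq : ∀ t ∈ Icc 0 h, z t = x₀ + ∫ s in (0 : ℝ)..t, (L (z s) + f s)) :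
    z h = NormedSpace.exp (h • L) x₀ + ∫ s in (0 : ℝ)..h, NormedSpace.exp ((h - s) • L) (f s) := by
  -- Extending the integrand continuously to `ℝ` makes the integral differentiable on `(0, h)`.
  set φ : ℝ → E := IccExtend hh (fun s : Icc 0 h => L (z s) + f s)
  have hφ : Continuous φ := by
    refine Continuous.Icc_extend' ?_
    exact continuousOn_iff_continuous_domRestrict.1 ((L.continuous.comp_continuousOn hz).add hf)
  have hφeq : ∀ s ∈ Icc 0 h, φ s = L (z s) + f s := fun s hs => IccExtend_of_mem _ _ hs
  have hzφ : ∀ t ∈ Icc 0 h, z t = x₀ + ∫ s in (0 : ℝ)..t, φ s := by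
    intro t ht
    rw [heq t ht]
    congr 1
    refine intervalIntegral.integral_congr fun s hs => (hφeq s ?_).symm
    rw [uIcc_of_le ht.1] at hs
    exact ⟨hs.1, hs.2.trans ht.2⟩
  have hz0 : z 0 = x₀ := by simpa using heq 0 (by simp [hh])
  set g : ℝ → E := fun t => NormedSpace.exp ((-t) • L) (z t)
  have hexp : Continuous fun t : ℝ => NormedSpace.exp ((-t) • L) :=
    (continuous_clm_exp_smul L).comp continuous_neg
  have hg : ContinuousOn g (Icc 0 h) := hexp.continuousOn.clm_apply hz
  have hg' : ∀ t ∈ Ioo 0 h, HasDerivAt g (NormedSpace.exp ((-t) • L) (f t)) t := by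
    intro t ht
    have h1 : HasDerivAt z (φ t) t := by
      have h2 : HasDerivAt (fun t => x₀ + ∫ s in (0 : ℝ)..t, φ s) (φ t) t :=
        (hφ.integral_hasStrictDerivAt 0 t).hasDerivAt.const_add _
      refine h2.congr_of_eventuallyEq ?_
      filter_upwards [Ioo_mem_nhds ht.1 ht.2] with s hs
      exact hzφ s ⟨hs.1.le, hs.2.le⟩
    have h3 : HasDerivAt (fun t : ℝ => NormedSpace.exp ((-t) • L))
        (-(NormedSpace.exp ((-t) • L) * L)) t := by
      have := (hasDerivAt_exp_smul_const L (-t)).scomp t (hasDerivAt_neg t)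
      simpa [Function.comp_def] using this
    have h4 := h3.clm_apply h1
    refine h4.congr_deriv ?_
    rw [hφeq t ⟨ht.1.le, ht.2.le⟩, map_add]
    simp
  have hint : IntervalIntegrable (fun t => NormedSpace.exp ((-t) • L) (f t)) volume 0 h := by
    refine ContinuousOn.intervalIntegrable ?_
    rw [uIcc_of_le hh]
    exact hexp.continuousOn.clm_apply hf
  have key := intervalIntegral.integral_eq_sub_of_hasDerivAt_of_le hh hg hg' hint
  have h5 : NormedSpace.exp (h • L) (g h) = z h := by
    change (NormedSpace.exp (h • L) * NormedSpace.exp ((-h) • L)) (z h) = z h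
    rw [clm_exp_smul_mul_exp_smul]
    simp
  have h6 : g 0 = x₀ := by simp [g, hz0]
  rw [← h5, ← sub_add_cancel (g h) (g 0), ← key, map_add, h6, add_comm,
    ← ContinuousLinearMap.intervalIntegral_comp_comm _ hint]
  congr 1
  refine intervalIntegral.integral_congr fun s _ => ?_
  change (NormedSpace.exp (h • L) * NormedSpace.exp ((-s) • L)) (f s) = _
  rw [clm_exp_smul_mul_exp_smul, sub_eq_add_neg]

end VariationOfConstants

/-! ### Integrals along a path as measurable functionals -/

section PathIntegral

variable {E : Type*} [NormedAddCommGroup E] [NormedSpace ℝ E]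

/-- The left-endpoint Riemann sum of `f` over `[0, h]` with `n + 1` intervals. -/
noncomputable def riemannSum (h : ℝ) (f : ℝ → E) (n : ℕ) : E :=
  ∑ i ∈ Finset.range (n + 1), (h / (n + 1)) • f (i * (h / (n + 1)))

lemma tendsto_riemannSum [CompleteSpace E] {h : ℝ} (hh : 0 < h) {f : ℝ → E} (hf : Continuous f) :
    Filter.Tendsto (riemannSum h f) Filter.atTop (nhds (∫ s in (0 : ℝ)..h, f s)) := by
  rw [Metric.tendsto_atTop]
  intro ε hε
  have huc := isCompact_Icc.uniformContinuousOn_of_continuous (hf.continuousOn (s := Icc 0 h))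
  rw [Metric.uniformContinuousOn_iff] at huc
  obtain ⟨δ, hδ, hfδ⟩ := huc (ε / (2 * h)) (by positivity)
  obtain ⟨N, hN⟩ := exists_nat_gt (h / δ)
  refine ⟨N, fun n hn => ?_⟩
  set τ : ℝ := h / (n + 1)
  have hn1 : (0 : ℝ) < n + 1 := by positivity
  have hτ : 0 < τ := by positivity
  have hτδ : τ < δ := by
    rw [div_lt_iff₀ hn1]
    rw [div_lt_iff₀ hδ] at hN
    have : (N : ℝ) ≤ n := by exact_mod_cast hn
    nlinarith
  have hτn : (n + 1) * τ = h := mul_div_cancel₀ _ hn1.ne'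
  have hsum := intervalIntegral.sum_integral_adjacent_intervals (f := f) (μ := volume)
    (a := fun i : ℕ => (i : ℝ) * τ) (n := n + 1) (fun k _ => hf.intervalIntegrable _ _)
  simp only [Nat.cast_zero, zero_mul, Nat.cast_add, Nat.cast_one, hτn] at hsum
  rw [dist_eq_norm, ← hsum, riemannSum, ← Finset.sum_sub_distrib]
  calc _ ≤ ∑ i ∈ Finset.range (n + 1), ε / (2 * h) * τ := by
        refine norm_sum_le_of_le _ fun i hi => ?_
        have hi' : (i : ℝ) + 1 ≤ n + 1 := by
          have := Finset.mem_range.1 hi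
          exact_mod_cast this
        have h1 : τ • f (i * τ) = ∫ _ in (i * τ)..((i + 1) * τ), f (i * τ) := by
          rw [intervalIntegral.integral_const]
          congr 1
          ring
        rw [h1, ← intervalIntegral.integral_sub (by simp) (hf.intervalIntegrable _ _)]
        have h2 := intervalIntegral.norm_integral_le_of_norm_le_const
          (f := fun s => f (i * τ) - f s) (a := i * τ) (b := (i + 1) * τ) (C := ε / (2 * h)) ?_
        · rwa [show (i + 1) * τ - i * τ = τ by ring, abs_of_pos hτ] at h2
        · intro s hs
          rw [uIoc_of_le (by nlinarith)] at hs
          have hi0 : 0 ≤ (i : ℝ) * τ := by positivity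
          have hih : (i + 1) * τ ≤ h := by rw [← hτn]; gcongr
          rw [← dist_eq_norm]
          refine (hfδ _ ⟨hi0, by linarith [hs.1, hs.2]⟩ _ ⟨by linarith [hs.1], hs.2.trans hih⟩ ?_).le
          rw [Real.dist_eq, abs_sub_comm, abs_of_nonneg (by linarith [hs.1])]
          linarith [hs.2]
    _ = ε / 2 := by
        rw [Finset.sum_const, Finset.card_range, nsmul_eq_mul]
        push_cast
        rw [mul_comm, mul_assoc, mul_comm τ, hτn]
        field_simp
    _ < ε := by linarith

/-- The limit of the Riemann sums of `K s (w s)` over `[0, h]`. It is the integral when `w` is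
continuous; unlike the integral, it depends measurably on `w` for the product `σ`-algebra. -/
noncomputable def pathIntegral (h : ℝ) (K : ℝ → E →L[ℝ] E) (w : ℝ≥0 → E) : E :=
  Filter.atTop.limUnder fun n => riemannSum h (fun s => K s (w s.toNNReal)) n

lemma pathIntegral_eq [CompleteSpace E] {h : ℝ} (hh : 0 < h) {K : ℝ → E →L[ℝ] E}
    (hK : Continuous K) {w : ℝ≥0 → E} (hw : Continuous w) :
    pathIntegral h K w = ∫ s in (0 : ℝ)..h, K s (w s.toNNReal) :=
  (tendsto_riemannSum hh (by fun_prop)).limUnder_eq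

lemma measurable_riemannSum [MeasurableSpace E] [BorelSpace E] [SecondCountableTopology E]
    (h : ℝ) (K : ℝ → E →L[ℝ] E) (n : ℕ) :
    Measurable fun w : ℝ≥0 → E => riemannSum h (fun s => K s (w s.toNNReal)) n := by
  unfold riemannSum
  fun_prop

lemma measurable_pathIntegral [MeasurableSpace E] [BorelSpace E] [SecondCountableTopology E]
    [CompleteSpace E] (h : ℝ) (K : ℝ → E →L[ℝ] E) : Measurable (pathIntegral h K) :=
  (StronglyMeasurable.limUnder fun n => (measurable_riemannSum h K n).stronglyMeasurable).measurable

end PathIntegral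

/-! ### The sampled system -/

section Sampling

variable {d p : ℕ}

/-- A square matrix as a continuous linear map of the Euclidean space. -/
noncomputable abbrev matCLM (A : Matrix (Fin d) (Fin d) ℝ) :
    EuclideanSpace ℝ (Fin d) →L[ℝ] EuclideanSpace ℝ (Fin d) :=
  Matrix.toEuclideanCLM (𝕜 := ℝ) A

lemma matCLM_apply (A : Matrix (Fin d) (Fin d) ℝ) (x : EuclideanSpace ℝ (Fin d)) :
    matCLM A x = Matrix.toEuclideanLin A x := rfl

lemma matCLM_mul (A B : Matrix (Fin d) (Fin d) ℝ) : matCLM (A * B) = matCLM A * matCLM B :=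
  map_mul _ _ _

lemma matCLM_smul (c : ℝ) (A : Matrix (Fin d) (Fin d) ℝ) : matCLM (c • A) = c • matCLM A :=
  map_smul _ _ _

lemma continuous_matCLM : Continuous (matCLM (d := d)) :=
  LinearMap.continuous_of_finiteDimensional
    (Matrix.toEuclideanCLM (n := Fin d) (𝕜 := ℝ)).toAlgEquiv.toLinearMap

lemma matCLM_exp (A : Matrix (Fin d) (Fin d) ℝ) :
    matCLM (NormedSpace.exp A) = NormedSpace.exp (matCLM A) := by
  let _ : NormedAlgebra ℚ (Matrix (Fin d) (Fin d) ℝ) := NormedAlgebra.restrictScalars ℚ ℝ _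
  exact NormedSpace.map_exp (Matrix.toEuclideanCLM (n := Fin d) (𝕜 := ℝ)) continuous_matCLM A

lemma toEuclideanLin_mul_apply {q : ℕ} (A : Matrix (Fin d) (Fin p) ℝ) (B : Matrix (Fin p) (Fin q) ℝ)
    (x : EuclideanSpace ℝ (Fin q)) : Matrix.toEuclideanLin (A * B) x =
      Matrix.toEuclideanLin A (Matrix.toEuclideanLin B x) := by
  ext i
  simp [Matrix.toLpLin_apply, Matrix.mulVec_mulVec]

/-- The kernel `e^{(h - s) A} A` through which the noise at time `s` enters the state at time `h`. -/
noncomputable def noiseKernel (h : ℝ) (A : Matrix (Fin d) (Fin d) ℝ) (s : ℝ) :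
    EuclideanSpace ℝ (Fin d) →L[ℝ] EuclideanSpace ℝ (Fin d) :=
  matCLM (NormedSpace.exp ((h - s) • A) * A)

lemma continuous_noiseKernel (h : ℝ) (A : Matrix (Fin d) (Fin d) ℝ) :
    Continuous (noiseKernel h A) := by
  have : Continuous fun s : ℝ => NormedSpace.exp ((h - s) • A) :=
    (continuous_exp_smul A).comp (by fun_prop)
  exact continuous_matCLM.comp (this.mul_const A)

/-- The contribution `v h + ∫₀ʰ e^{(h - s) A} A v_s ds` of a noise path `v` to the state after time
`h`. -/
noncomputable def pathNoise (h : ℝ) (A : Matrix (Fin d) (Fin d) ℝ)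
    (v : ℝ≥0 → EuclideanSpace ℝ (Fin d)) : EuclideanSpace ℝ (Fin d) :=
  v h.toNNReal + pathIntegral h (noiseKernel h A) v

lemma measurable_pathNoise (h : ℝ) (A : Matrix (Fin d) (Fin d) ℝ) :
    Measurable (pathNoise h A) :=
  (measurable_pi_apply _).add (measurable_pathIntegral h _)

/-- The increments of the path `w` after the time `k h`. -/
noncomputable def incr {E : Type*} [Sub E] (h : ℝ) (k : ℕ) (w : ℝ≥0 → E) (s : ℝ≥0) : E :=
  w (sampleTime h k + s) - w (sampleTime h k)

/-- The state at time `k h` as a function of the initial state, the inputs and the noise path. -/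
noncomputable def stateMap (h : ℝ) (A : Matrix (Fin d) (Fin d) ℝ) (B : Matrix (Fin d) (Fin p) ℝ)
    (x₀ : EuclideanSpace ℝ (Fin d)) (u : ℕ → EuclideanSpace ℝ (Fin p))
    (w : ℝ≥0 → EuclideanSpace ℝ (Fin d)) : ℕ → EuclideanSpace ℝ (Fin d)
  | 0 => x₀
  | k + 1 => Matrix.toEuclideanLin (NormedSpace.exp (h • A)) (stateMap h A B x₀ u w k) +
      Matrix.toEuclideanLin (expIntegral h A * B) (u k) + pathNoise h A (incr h k w)

lemma measurable_toEuclideanLin {q : ℕ} (M : Matrix (Fin d) (Fin q) ℝ) :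
    Measurable (Matrix.toEuclideanLin M) :=
  (LinearMap.continuous_of_finiteDimensional _).measurable

lemma measurable_incr (h : ℝ) (k : ℕ) :
    Measurable (incr (E := EuclideanSpace ℝ (Fin d)) h k) := by
  unfold incr
  fun_prop

lemma measurable_stateMap (h : ℝ) (A : Matrix (Fin d) (Fin d) ℝ) (B : Matrix (Fin d) (Fin p) ℝ)
    (k : ℕ) :
    Measurable fun q : EuclideanSpace ℝ (Fin d) × (ℕ → EuclideanSpace ℝ (Fin p)) ×
      (ℝ≥0 → EuclideanSpace ℝ (Fin d)) => stateMap h A B q.1 q.2.1 q.2.2 k := by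
  induction k with
  | zero => exact measurable_fst
  | succ k ih =>
    refine (((measurable_toEuclideanLin _).comp ih).add
      ((measurable_toEuclideanLin _).comp ?_)).add
      ((measurable_pathNoise h A).comp ((measurable_incr h k).comp ?_))
    · fun_prop
    · fun_prop

lemma coe_sampleTime {h : ℝ} (hh : 0 < h) (k : ℕ) : (sampleTime h k : ℝ) = k * h :=
  Real.coe_toNNReal _ (by positivity)

lemma sampleTime_succ {h : ℝ} (hh : 0 < h) (k : ℕ) :
    sampleTime h (k + 1) = sampleTime h k + h.toNNReal := by
  ext
  rw [NNReal.coe_add, coe_sampleTime hh, coe_sampleTime hh, Real.coe_toNNReal _ hh.le]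
  push_cast
  ring

lemma sampleTime_mono {h : ℝ} (hh : 0 < h) : Monotone (sampleTime h) := by
  intro i j hij
  rw [← NNReal.coe_le_coe, coe_sampleTime hh, coe_sampleTime hh]
  gcongr

lemma continuous_incr {h : ℝ} {k : ℕ} {w : ℝ≥0 → EuclideanSpace ℝ (Fin d)} (hw : Continuous w) :
    Continuous (incr h k w) := by
  unfold incr
  fun_prop

lemma pathNoise_eq {h : ℝ} (hh : 0 < h) (A : Matrix (Fin d) (Fin d) ℝ)
    {v : ℝ≥0 → EuclideanSpace ℝ (Fin d)} (hv : Continuous v) :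
    pathNoise h A v = v h.toNNReal + ∫ s in (0 : ℝ)..h, noiseKernel h A s (v s.toNNReal) := by
  rw [pathNoise, pathIntegral_eq hh (continuous_noiseKernel h A) hv]

lemma holdInput_eq {n : ℕ} {h : ℝ} (hh : 0 < h) (u : Fin n → EuclideanSpace ℝ (Fin p)) (k : Fin n)
    {r : ℝ} (hr0 : 0 ≤ r) (hr : r < h) : holdInput h u (k * h + r) = u k := by
  have : ⌊(k * h + r) / h⌋₊ = (k : ℕ) := by
    rw [Nat.floor_eq_iff (by positivity)]
    constructor
    · rw [le_div_iff₀ hh]; linarith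
    · rw [div_lt_iff₀ hh]; linarith
  simp [holdInput, this]

lemma intervalIntegrable_holdInput {n : ℕ} (h : ℝ) (u : Fin n → EuclideanSpace ℝ (Fin p))
    (B : Matrix (Fin d) (Fin p) ℝ) (a b : ℝ) :
    IntervalIntegrable (fun s => Matrix.toEuclideanLin B (holdInput h u s)) volume a b := by
  have hm : Measurable fun s => Matrix.toEuclideanLin B (holdInput h u s) := by
    refine (measurable_toEuclideanLin B).comp ?_
    have : Measurable fun k : ℕ => if hk : k < n then u ⟨k, hk⟩ else 0 := measurable_from_nat
    exact this.comp (Nat.measurable_floor.comp (measurable_id.div_const h))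
  have hb : ∀ s, ‖Matrix.toEuclideanLin B (holdInput h u s)‖ ≤
      ∑ k, ‖Matrix.toEuclideanLin B (u k)‖ := by
    intro s
    unfold holdInput
    split_ifs with hk
    · exact Finset.single_le_sum (f := fun k => ‖Matrix.toEuclideanLin B (u k)‖)
        (fun _ _ => norm_nonneg _) (Finset.mem_univ _)
    · simp only [map_zero, norm_zero]
      positivity
  rw [intervalIntegrable_iff]
  exact Measure.integrableOn_of_bounded (by simp) hm.aestronglyMeasurable (ae_of_all _ hb)

/-- Integrals of matrices act on vectors pointwise. -/
lemma integral_matCLM_apply {F : ℝ → Matrix (Fin d) (Fin d) ℝ} (hF : Continuous F) (a b : ℝ)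
    (y : EuclideanSpace ℝ (Fin d)) :
    ∫ s in a..b, matCLM (F s) y = Matrix.toEuclideanLin (∫ s in a..b, F s) y := by
  let Φ : Matrix (Fin d) (Fin d) ℝ →L[ℝ] EuclideanSpace ℝ (Fin d) :=
    LinearMap.toContinuousLinearMap
      { toFun := fun M => matCLM M y
        map_add' := fun M N => by simp [matCLM]
        map_smul' := fun c M => by simp [matCLM] }
  have hΦ : ∀ M, Φ M = matCLM M y := fun _ => rfl
  have := Φ.intervalIntegral_comp_comm (hF.intervalIntegrable (μ := volume) a b)
  simp only [hΦ] at this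
  rw [this, matCLM_apply]

/-- The integral equation of the noise-free part of the state over one sampling interval. -/
lemma variation_of_constants_matrix {h : ℝ} (hh : 0 < h) (A : Matrix (Fin d) (Fin d) ℝ)
    {z v : ℝ → EuclideanSpace ℝ (Fin d)} {x₀ b : EuclideanSpace ℝ (Fin d)}
    (hz : ContinuousOn z (Icc 0 h)) (hv : Continuous v)
    (heq : ∀ t ∈ Icc 0 h, z t = x₀ + ∫ s in (0 : ℝ)..t, (matCLM A (z s) + (matCLM A (v s) + b))) :
    z h = Matrix.toEuclideanLin (NormedSpace.exp (h • A)) x₀ +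
      Matrix.toEuclideanLin (expIntegral h A) b + ∫ s in (0 : ℝ)..h, noiseKernel h A s (v s) := by
  have key := variation_of_constants (matCLM A) hh.le hz
    (((matCLM A).continuous.comp hv).add_const b).continuousOn heq
  have hexp (r : ℝ) : NormedSpace.exp (r • matCLM A) = matCLM (NormedSpace.exp (r • A)) := by
    rw [matCLM_exp, matCLM_smul]
  simp_rw [hexp, map_add, Function.comp_apply] at key
  have hce : Continuous fun s : ℝ => NormedSpace.exp ((h - s) • A) :=
    (continuous_exp_smul A).comp (by fun_prop)
  have hcm : Continuous fun s : ℝ => matCLM (NormedSpace.exp ((h - s) • A)) :=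
    continuous_matCLM.comp hce
  have hi1 : IntervalIntegrable (fun s : ℝ => matCLM (NormedSpace.exp ((h - s) • A))
      (matCLM A (v s))) volume 0 h :=
    (hcm.clm_apply ((matCLM A).continuous.comp hv)).intervalIntegrable _ _
  have hi2 : IntervalIntegrable (fun s : ℝ => matCLM (NormedSpace.exp ((h - s) • A)) b)
      volume 0 h := (hcm.clm_apply continuous_const).intervalIntegrable _ _
  have hI : ∫ s in (0 : ℝ)..h, NormedSpace.exp ((h - s) • A) = expIntegral h A := by
    have h1 := intervalIntegral.integral_comp_sub_left (a := 0) (b := h)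
      (fun s => NormedSpace.exp (s • A)) h
    rw [sub_self, sub_zero] at h1
    exact h1
  have hK (s : ℝ) : matCLM (NormedSpace.exp ((h - s) • A)) (matCLM A (v s)) =
      noiseKernel h A s (v s) := by
    rw [noiseKernel, matCLM_mul]
    rfl
  rw [key, intervalIntegral.integral_add hi1 hi2, integral_matCLM_apply hce, hI, matCLM_apply]
  simp_rw [hK]
  abel

/-- One step of the sampled system. -/
lemma sample_step {n : ℕ} {h : ℝ} (hh : 0 < h) {A : Matrix (Fin d) (Fin d) ℝ}
    {B : Matrix (Fin d) (Fin p) ℝ} {u : Fin n → EuclideanSpace ℝ (Fin p)}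
    {w x : ℝ≥0 → EuclideanSpace ℝ (Fin d)} (hw : Continuous w)
    (hx : SolvesSDE A B (n * h) (holdInput h u) w x) (k : Fin n) :
    x (sampleTime h (k + 1)) =
      Matrix.toEuclideanLin (NormedSpace.exp (h • A)) (x (sampleTime h k)) +
      Matrix.toEuclideanLin (expIntegral h A * B) (u k) + pathNoise h A (incr h k w) := by
  obtain ⟨hxc, hxe⟩ := hx
  have hk1 : ((k : ℕ) : ℝ) + 1 ≤ n := by exact_mod_cast k.2
  set a : ℝ := k * h
  have ha : 0 ≤ a := by positivity
  have hah : a + h ≤ n * h := by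
    have : ((k : ℕ) + 1 : ℝ) * h ≤ n * h := by gcongr
    linarith
  set v := incr h k w
  have hv : Continuous v := continuous_incr hw
  set b := Matrix.toEuclideanLin B (u k)
  set xr : ℝ → EuclideanSpace ℝ (Fin d) := fun s => x s.toNNReal
  have hxr : ContinuousOn xr (Iic (n * h)) := by
    refine hxc.comp (by fun_prop) fun s hs => ?_
    have hs' : s ≤ n * h := hs
    change ((s.toNNReal : ℝ≥0) : ℝ) ≤ n * h
    rw [Real.coe_toNNReal']
    exact max_le hs' (by linarith)
  have hst : sampleTime h k = a.toNNReal := rfl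
  have hAx : ContinuousOn (fun s => Matrix.toEuclideanLin A (xr s)) (Iic (n * h)) :=
    (matCLM A).continuous.comp_continuousOn hxr
  have hint : ∀ c e, c ≤ n * h → e ≤ n * h → IntervalIntegrable (fun s =>
      Matrix.toEuclideanLin A (xr s) + Matrix.toEuclideanLin B (holdInput h u s)) volume c e := by
    intro c e hc he
    refine IntervalIntegrable.add ?_ (intervalIntegrable_holdInput h u B c e)
    refine (hAx.mono fun s hs => ?_).intervalIntegrable
    exact hs.2.trans (max_le hc he)
  set z : ℝ → EuclideanSpace ℝ (Fin d) := fun s => xr (a + s) - v s.toNNReal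
  have hvs (s : ℝ) (hs : 0 ≤ s) : v s.toNNReal = w (a + s).toNNReal - w a.toNNReal := by
    rw [Real.toNNReal_add ha hs]
    rfl
  have hz : ContinuousOn z (Icc 0 h) := by
    refine ContinuousOn.sub (hxr.comp (by fun_prop) fun s hs => ?_) (by fun_prop)
    simp only [mem_Iic]
    linarith [hs.2]
  have heq : ∀ t ∈ Icc 0 h, z t = xr a + ∫ s in (0 : ℝ)..t,
      (matCLM A (z s) + (matCLM A (v s.toNNReal) + b)) := by
    intro t ht
    have e1 := hxe (a + t).toNNReal (by
      rw [Real.coe_toNNReal _ (by linarith [ht.1])]; linarith [ht.2])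
    have e2 := hxe a.toNNReal (by rw [Real.coe_toNNReal _ ha]; linarith)
    rw [Real.coe_toNNReal _ (by linarith [ht.1])] at e1
    rw [Real.coe_toNNReal _ ha] at e2
    have e3 : ∫ s in (0 : ℝ)..t, (matCLM A (z s) + (matCLM A (v s.toNNReal) + b)) =
        ∫ s in a..(a + t), (Matrix.toEuclideanLin A (xr s) +
          Matrix.toEuclideanLin B (holdInput h u s)) := by
      have := intervalIntegral.integral_comp_add_left (a := 0) (b := t)
        (fun s => Matrix.toEuclideanLin A (xr s) + Matrix.toEuclideanLin B (holdInput h u s)) a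
      rw [add_zero] at this
      rw [← this]
      refine intervalIntegral.integral_congr_uIoo fun s hs => ?_
      rw [uIoo_of_le ht.1] at hs
      rw [holdInput_eq hh u k hs.1.le (hs.2.trans_le ht.2), ← add_assoc, ← map_add]
      simp only [z, sub_add_cancel]
      rfl
    rw [e3]
    have e4 := intervalIntegral.integral_add_adjacent_intervals
      (hint 0 a (by linarith) (by linarith)) (hint a (a + t) (by linarith) (by linarith [ht.2]))
    simp only [z, hvs t ht.1]
    simp only [xr] at e4 ⊢
    rw [e1, e2, ← e4]
    abel
  have key := variation_of_constants_matrix hh A hz (hv.comp continuous_real_toNNReal) heq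
  have hxs : x (sampleTime h (k + 1)) = z h + v h.toNNReal := by
    simp only [z, sub_add_cancel, xr]
    congr 1
    rw [sampleTime]
    congr 1
    push_cast
    ring
  rw [hxs, key, pathNoise_eq hh A hv, toEuclideanLin_mul_apply, hst]
  simp only [Function.comp_apply]
  abel

/-- The states at the sampling times are given by `stateMap`. -/
lemma eq_stateMap {n : ℕ} {h : ℝ} (hh : 0 < h) {A : Matrix (Fin d) (Fin d) ℝ}
    {B : Matrix (Fin d) (Fin p) ℝ} {u : Fin n → EuclideanSpace ℝ (Fin p)}
    {u' : ℕ → EuclideanSpace ℝ (Fin p)}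
    {w x : ℝ≥0 → EuclideanSpace ℝ (Fin d)} (hw : Continuous w)
    (hx : SolvesSDE A B (n * h) (holdInput h u) w x) {k : ℕ} (hk : k ≤ n)
    (hu : ∀ i : Fin n, (i : ℕ) < k → u' i = u i) :
    x (sampleTime h k) = stateMap h A B (x 0) u' w k := by
  induction k with
  | zero => simp [stateMap, sampleTime]
  | succ k ih =>
    have := sample_step hh hw hx ⟨k, hk⟩
    rw [this, stateMap, ← ih (by omega) (fun i hi => hu i (by omega)), ← hu ⟨k, hk⟩ (by simp)]

/-- The state at time `k h` depends only on the noise up to that time. -/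
lemma stateMap_congr {h : ℝ} (hh : 0 < h) {A : Matrix (Fin d) (Fin d) ℝ}
    {B : Matrix (Fin d) (Fin p) ℝ} {x₀ : EuclideanSpace ℝ (Fin d)}
    {u : ℕ → EuclideanSpace ℝ (Fin p)} {w w' : ℝ≥0 → EuclideanSpace ℝ (Fin d)}
    (hw : Continuous w) (hw' : Continuous w') {k : ℕ}
    (heq : ∀ s ≤ sampleTime h k, w s = w' s) :
    stateMap h A B x₀ u w k = stateMap h A B x₀ u w' k := by
  induction k with
  | zero => rfl
  | succ k ih =>
    have hle : sampleTime h k ≤ sampleTime h (k + 1) := sampleTime_mono hh (by simp)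
    have hi : ∀ s ≤ h.toNNReal, incr h k w s = incr h k w' s := by
      intro s hs
      rw [incr, incr, heq _ hle, heq]
      rw [sampleTime_succ hh]
      gcongr
    rw [stateMap, stateMap, ih fun s hs => heq s (hs.trans hle)]
    congr 1
    rw [pathNoise_eq hh A (continuous_incr hw), pathNoise_eq hh A (continuous_incr hw'), hi _ le_rfl]
    congr 1
    refine intervalIntegral.integral_congr fun s hs => ?_
    rw [uIcc_of_le hh.le] at hs
    rw [hi _ (Real.toNNReal_le_toNNReal hs.2)]

/-- The path `w` up to the time `(k + 1) h`, with the increment over `[k h, (k + 1) h]` removed by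
subtracting its linear interpolation: a Brownian bridge on that interval if `w` is Brownian. -/
noncomputable def bridge {E : Type*} [AddCommGroup E] [Module ℝ E] (h : ℝ) (k : ℕ) (w : ℝ≥0 → E)
    (s : ℝ≥0) : E :=
  w (min s (sampleTime h (k + 1))) -
    (((min s (sampleTime h (k + 1)) : ℝ≥0) - (min s (sampleTime h k) : ℝ≥0) : ℝ) / h) •
      (w (sampleTime h (k + 1)) - w (sampleTime h k))

/-- The matrix through which the increment of the noise over a sampling interval enters the state at
the end of that interval, when the noise is decomposed into its increment and a bridge. -/
noncomputable def bridgeGain (h : ℝ) (A : Matrix (Fin d) (Fin d) ℝ) : Matrix (Fin d) (Fin d) ℝ :=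
  1 + ∫ s in (0 : ℝ)..h, (s / h) • (NormedSpace.exp ((h - s) • A) * A)

lemma norm_noiseMatrix_le [NeZero d] {h : ℝ} {A : Matrix (Fin d) (Fin d) ℝ}
    (hA : h * ‖A‖ ≤ 1 / 15) {s : ℝ} (hs0 : 0 ≤ s) (hs : s ≤ h) :
    ‖NormedSpace.exp ((h - s) • A) * A‖ ≤ 2 * ‖A‖ := by
  have h1 : ‖(h - s) • A‖ ≤ 1 / 15 := by
    rw [norm_smul, Real.norm_of_nonneg (by linarith)]
    refine le_trans ?_ hA
    gcongr
    linarith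
  have h2 : Real.exp (1 / 15) ≤ 1 / (1 - 1 / 15) :=
    Real.exp_bound_div_one_sub_of_interval (by norm_num) (by norm_num)
  have h3 : ‖NormedSpace.exp ((h - s) • A)‖ ≤ 2 := (norm_exp_le h1).trans (by linarith)
  exact (norm_mul_le _ _).trans (by gcongr)

lemma norm_bridgeGain_sub_one_le [NeZero d] {h : ℝ} (hh : 0 < h) {A : Matrix (Fin d) (Fin d) ℝ}
    (hA : h * ‖A‖ ≤ 1 / 15) : ‖bridgeGain h A - 1‖ ≤ 1 / 4 := by
  have hb : ∀ s ∈ uIoc 0 h, ‖(s / h) • (NormedSpace.exp ((h - s) • A) * A)‖ ≤ 2 * ‖A‖ := by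
    intro s hs
    rw [uIoc_of_le hh.le] at hs
    have h4 : ‖s / h‖ ≤ 1 := by
      rw [Real.norm_of_nonneg (div_nonneg hs.1.le hh.le)]
      exact (div_le_one hh).2 hs.2
    rw [norm_smul]
    calc ‖s / h‖ * ‖NormedSpace.exp ((h - s) • A) * A‖ ≤ 1 * (2 * ‖A‖) := by
          gcongr
          exact norm_noiseMatrix_le hA hs.1.le hs.2
      _ = _ := one_mul _
  have := intervalIntegral.norm_integral_le_of_norm_le_const hb
  rw [sub_zero, abs_of_pos hh] at this
  rw [bridgeGain, add_sub_cancel_left]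
  linarith

lemma continuous_bridge {h : ℝ} {k : ℕ} {w : ℝ≥0 → EuclideanSpace ℝ (Fin d)} (hw : Continuous w) :
    Continuous (bridge h k w) := by
  unfold bridge
  fun_prop

lemma measurable_bridge (h : ℝ) (k : ℕ) :
    Measurable (bridge (E := EuclideanSpace ℝ (Fin d)) h k) := by
  unfold bridge
  fun_prop

/-- The state as the sum of a function of the bridge and a linear image of the increment. -/
lemma stateMap_eq_bridge_add {h : ℝ} (hh : 0 < h) {A : Matrix (Fin d) (Fin d) ℝ}
    {B : Matrix (Fin d) (Fin p) ℝ} {x₀ : EuclideanSpace ℝ (Fin d)}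
    {u : ℕ → EuclideanSpace ℝ (Fin p)} {w : ℝ≥0 → EuclideanSpace ℝ (Fin d)}
    (hw : Continuous w) (k : ℕ) :
    stateMap h A B x₀ u w (k + 1) = stateMap h A B x₀ u (bridge h k w) (k + 1) +
      Matrix.toEuclideanLin (bridgeGain h A)
        (w (sampleTime h (k + 1)) - w (sampleTime h k)) := by
  set t₀ := sampleTime h k
  set t₁ := sampleTime h (k + 1)
  set Δ := w t₁ - w t₀
  have ht : t₁ = t₀ + h.toNNReal := sampleTime_succ hh k
  have hle : t₀ ≤ t₁ := by rw [ht]; simp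
  have hb := continuous_bridge (h := h) (k := k) hw
  have hpast : ∀ s ≤ t₀, bridge h k w s = w s := by
    intro s hs
    rw [bridge, min_eq_left (hs.trans hle), min_eq_left hs]
    simp
  have hincr : ∀ s ≤ h.toNNReal, incr h k w s = incr h k (bridge h k w) s + ((s : ℝ) / h) • Δ := by
    intro s hs
    have h1 : t₀ + s ≤ t₁ := by rw [ht]; gcongr
    rw [incr, incr, hpast _ le_rfl, bridge, min_eq_left h1, min_eq_right (by simp)]
    simp only [NNReal.coe_add, add_sub_cancel_left, t₀, t₁, Δ]
    abel
  have hcs : Continuous fun s : ℝ => (s / h) • (NormedSpace.exp ((h - s) • A) * A) := by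
    have : Continuous fun s : ℝ => NormedSpace.exp ((h - s) • A) :=
      (continuous_exp_smul A).comp (by fun_prop)
    exact (continuous_id.div_const h).smul (this.mul_const A)
  have hgain : Matrix.toEuclideanLin (bridgeGain h A) Δ =
      Δ + ∫ s in (0 : ℝ)..h, noiseKernel h A s ((s / h) • Δ) := by
    have h1 : ∀ s, noiseKernel h A s ((s / h) • Δ) =
        matCLM ((s / h) • (NormedSpace.exp ((h - s) • A) * A)) Δ := by
      intro s
      rw [map_smul, noiseKernel, matCLM_smul]
      rfl
    simp_rw [h1]
    rw [integral_matCLM_apply hcs, bridgeGain, map_add]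
    simp
  have hKb : Continuous fun s : ℝ => noiseKernel h A s (incr h k (bridge h k w) s.toNNReal) :=
    (continuous_noiseKernel h A).clm_apply ((continuous_incr hb).comp continuous_real_toNNReal)
  have hKl : Continuous fun s : ℝ => noiseKernel h A s ((s / h) • Δ) :=
    (continuous_noiseKernel h A).clm_apply (by fun_prop)
  have hnoise : pathNoise h A (incr h k w) = pathNoise h A (incr h k (bridge h k w)) +
      Matrix.toEuclideanLin (bridgeGain h A) Δ := by
    rw [pathNoise_eq hh A (continuous_incr hw), pathNoise_eq hh A (continuous_incr hb), hgain,
      hincr _ le_rfl, Real.coe_toNNReal _ hh.le, div_self hh.ne', one_smul]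
    have : ∫ s in (0 : ℝ)..h, noiseKernel h A s (incr h k w s.toNNReal) =
        (∫ s in (0 : ℝ)..h, noiseKernel h A s (incr h k (bridge h k w) s.toNNReal)) +
          ∫ s in (0 : ℝ)..h, noiseKernel h A s ((s / h) • Δ) := by
      rw [← intervalIntegral.integral_add (hKb.intervalIntegrable _ _)
        (hKl.intervalIntegrable _ _)]
      refine intervalIntegral.integral_congr fun s hs => ?_
      rw [uIcc_of_le hh.le] at hs
      simp only [hincr _ (Real.toNNReal_le_toNNReal hs.2), Real.coe_toNNReal _ hs.1, map_add]
    rw [this]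
    abel
  rw [stateMap, stateMap, hnoise, stateMap_congr hh hw hb fun s hs => (hpast s hs).symm]
  abel

end Sampling

/-! ### Sub-Gaussian variables -/

section SubGaussian

variable {Ω : Type*} [MeasurableSpace Ω] {μ : Measure Ω}

lemma hasSubgaussianMGF_mono {X : Ω → ℝ} {c c' : ℝ≥0} (h : HasSubgaussianMGF X c μ) (hc : c ≤ c') :
    HasSubgaussianMGF X c' μ where
  integrable_exp_mul := h.integrable_exp_mul
  mgf_le t := (h.mgf_le t).trans (by gcongr)

lemma hasSubgaussianMGF_of_hasLaw {X : Ω → ℝ} {v : ℝ≥0} (h : HasLaw X (gaussianReal 0 v) μ) :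
    HasSubgaussianMGF X v μ where
  integrable_exp_mul t := by
    have h1 := integrable_exp_mul_gaussianReal (μ := 0) (v := v) t
    rw [← h.map_eq] at h1
    exact h1.comp_aemeasurable h.aemeasurable
  mgf_le t := by
    rw [mgf_gaussianReal h.map_eq]
    simp

/-- A sum of sub-Gaussian variables is sub-Gaussian, without independence: the standard deviation
proxies add up. -/
lemma hasSubgaussianMGF_sum [IsProbabilityMeasure μ] {ι : Type*} (s : Finset ι) {X : ι → Ω → ℝ}
    {σ : ι → ℝ≥0} (h : ∀ i ∈ s, HasSubgaussianMGF (X i) (σ i ^ 2) μ) :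
    HasSubgaussianMGF (fun ω => ∑ i ∈ s, X i ω) ((∑ i ∈ s, σ i) ^ 2) μ := by
  classical
  induction s using Finset.induction_on with
  | empty => simp
  | insert a s ha ih =>
    have := (h a (by simp)).add (ih fun i hi => h i (by simp [hi]))
    simp only [NNReal.sqrt_sq] at this
    simpa [Finset.sum_insert ha] using this

lemma hasSubgaussianMGF_mul_sq {X : Ω → ℝ} {σ : ℝ≥0} (h : HasSubgaussianMGF X (σ ^ 2) μ) {r : ℝ}
    {ρ : ℝ≥0} (hr : |r| ≤ ρ) : HasSubgaussianMGF (fun ω => r * X ω) ((ρ * σ) ^ 2) μ := by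
  refine hasSubgaussianMGF_mono (hasSubgaussianMGF_const_mul h r) ?_
  rw [mul_pow]
  gcongr
  exact hr

/-- The sub-Gaussian property passes to almost sure limits. -/
lemma hasSubgaussianMGF_of_tendsto {X : ℕ → Ω → ℝ} {Y : Ω → ℝ} {c : ℝ≥0}
    (h : ∀ n, HasSubgaussianMGF (X n) c μ)
    (hY : ∀ᵐ ω ∂μ, Filter.Tendsto (fun n => X n ω) Filter.atTop (nhds (Y ω))) :
    HasSubgaussianMGF Y c μ := by
  have hmX : ∀ n, AEMeasurable (X n) μ := fun n => (h n).aemeasurable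
  have hmY : AEMeasurable Y μ := aemeasurable_of_tendsto_metrizable_ae _ hmX hY
  have hbound : ∀ t : ℝ, ∫⁻ ω, ENNReal.ofReal (Real.exp (t * Y ω)) ∂μ ≤
      ENNReal.ofReal (Real.exp (c * t ^ 2 / 2)) := by
    intro t
    calc ∫⁻ ω, ENNReal.ofReal (Real.exp (t * Y ω)) ∂μ
        = ∫⁻ ω, Filter.liminf (fun n => ENNReal.ofReal (Real.exp (t * X n ω))) Filter.atTop ∂μ := by
          refine lintegral_congr_ae ?_
          filter_upwards [hY] with ω hω
          refine (Filter.Tendsto.liminf_eq ?_).symm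
          exact ENNReal.tendsto_ofReal ((Real.continuous_exp.tendsto _).comp (hω.const_mul t))
      _ ≤ Filter.liminf (fun n => ∫⁻ ω, ENNReal.ofReal (Real.exp (t * X n ω)) ∂μ) Filter.atTop := by
          refine lintegral_liminf_le' fun n => ?_
          exact ((hmX n).const_mul t).exp.ennreal_ofReal
      _ ≤ ENNReal.ofReal (Real.exp (c * t ^ 2 / 2)) := by
          refine Filter.liminf_le_of_frequently_le' (Filter.Frequently.of_forall fun n => ?_)
          rw [← ofReal_integral_eq_lintegral_ofReal ((h n).integrable_exp_mul t)
            (ae_of_all _ fun _ => (Real.exp_pos _).le)]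
          exact ENNReal.ofReal_le_ofReal ((h n).mgf_le t)
  have hint : ∀ t : ℝ, Integrable (fun ω => Real.exp (t * Y ω)) μ := by
    intro t
    refine ⟨(hmY.const_mul t).exp.aestronglyMeasurable, ?_⟩
    rw [hasFiniteIntegral_iff_ofReal (ae_of_all _ fun _ => (Real.exp_pos _).le)]
    exact (hbound t).trans_lt ENNReal.ofReal_lt_top
  refine ⟨hint, fun t => ?_⟩
  rw [mgf, integral_eq_lintegral_of_nonneg_ae (ae_of_all _ fun _ => (Real.exp_pos _).le)
    (hint t).aestronglyMeasurable]
  exact ENNReal.toReal_le_of_le_ofReal (Real.exp_pos _).le (hbound t)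

end SubGaussian

/-! ### Brownian motion: increments, bridges and shifts -/

section Brownian

variable {Ω : Type*} [MeasurableSpace Ω] {μ : Measure Ω}

/-- The bridge of a Brownian motion is independent of the increment it is obtained from. -/
lemma indepFun_bridge_real {X : ℝ≥0 → Ω → ℝ} (hX : IsBrownianReal X μ) {h : ℝ} (hh : 0 < h)
    (k : ℕ) :
    IndepFun (fun ω => bridge h k fun t => X t ω)
      (fun ω => X (sampleTime h (k + 1)) ω - X (sampleTime h k) ω) μ := by
  have hP : IsProbabilityMeasure μ := hX.isGaussianProcess.isProbabilityMeasure
  have hL2 : ∀ t, MemLp (X t) 2 μ := fun t => (hX.isGaussianProcess.hasGaussianLaw_eval t).memLp_two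
  set t₀ := sampleTime h k
  set t₁ := sampleTime h (k + 1)
  have ht : t₁ = t₀ + h.toNNReal := sampleTime_succ hh k
  have hle : t₀ ≤ t₁ := by rw [ht]; simp
  have hsub : (t₁ : ℝ) - t₀ = h := by
    rw [ht, NNReal.coe_add, add_sub_cancel_left, Real.coe_toNNReal _ hh.le]
  have hm : ∀ t, AEMeasurable (X t) μ := fun t => hX.aemeasurable t
  have key : IndepFun (fun ω s => bridge h k (fun t => X t ω) s)
      (fun ω (_ : Unit) => X t₁ ω - X t₀ ω) μ := by
    refine IsGaussianProcess.indepFun_of_covariance_eq_zero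
      (X := fun s ω => bridge h k (fun t => X t ω) s) (Y := fun (_ : Unit) ω => X t₁ ω - X t₀ ω)
      ?_ ?_ ?_ ?_
    · refine hX.isGaussianProcess.of_isGaussianProcess ?_
      classical
      rintro (s | ⟨⟩)
      · exact ⟨{min s t₁, t₁, t₀},
          { toFun x := x ⟨min s t₁, by simp⟩ -
              (((min s t₁ : ℝ≥0) - (min s t₀ : ℝ≥0) : ℝ) / h) • (x ⟨t₁, by simp⟩ - x ⟨t₀, by simp⟩)
            map_add' x y := by simp; ring
            map_smul' c x := by simp; ring }, fun ω => rfl⟩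
      · exact ⟨{t₁, t₀},
          { toFun x := x ⟨t₁, by simp⟩ - x ⟨t₀, by simp⟩
            map_add' x y := by simp; ring
            map_smul' c x := by simp; ring }, fun ω => rfl⟩
    · intro s
      unfold bridge
      exact (hm _).sub (((hm _).sub (hm _)).const_mul _)
    · exact fun _ => (hm _).sub (hm _)
    · intro s _
      have hG : MemLp (fun ω => X t₁ ω - X t₀ ω) 2 μ := (hL2 _).sub (hL2 _)
      simp only [bridge, smul_eq_mul]
      rw [covariance_fun_sub_left (hL2 _) (hG.const_mul _) hG, covariance_const_mul_left,
        covariance_fun_sub_right (hL2 _) (hL2 _) (hL2 _), covariance_fun_sub_left (hL2 _) (hL2 _) hG,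
        covariance_fun_sub_right (hL2 _) (hL2 _) (hL2 _),
        covariance_fun_sub_right (hL2 _) (hL2 _) (hL2 _)]
      simp only [hX.covariance_fun_eval]
      rw [min_assoc, min_self, min_assoc, min_eq_right hle, min_self, min_eq_left hle, sub_self,
        sub_zero, show (sampleTime h (k + 1) : ℝ) - t₀ = h from hsub, div_mul_cancel₀ _ hh.ne']
      exact sub_self _
  exact key.comp measurable_id (measurable_pi_apply ())

variable {d : ℕ} {W : ℝ≥0 → Ω → EuclideanSpace ℝ (Fin d)}

lemma IsStdBrownian.measurable_path (hW : IsStdBrownian μ W) : Measurable fun ω t => W t ω :=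
  measurable_pi_lambda _ hW.measurable

lemma IsStdBrownian.ae_continuous (hW : IsStdBrownian μ W) : ∀ᵐ ω ∂μ, Continuous fun t => W t ω := by
  have := ae_all_iff.2 fun i => (hW.coord i).cont
  filter_upwards [this] with ω hω
  have h1 : (fun t => W t ω) = fun t => WithLp.toLp 2 fun i => W t ω i := rfl
  rw [h1]
  exact (PiLp.continuous_toLp 2 _).comp (continuous_pi hω)

/-- Functionals of the coordinate paths that are independent in each coordinate are independent. -/
lemma IsStdBrownian.indepFun_coord [IsProbabilityMeasure μ] (hW : IsStdBrownian μ W) {α β : Type*}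
    [MeasurableSpace α] [MeasurableSpace β] {φ : (ℝ≥0 → ℝ) → α} {ψ : (ℝ≥0 → ℝ) → β}
    (hφ : Measurable φ) (hψ : Measurable ψ)
    (h : ∀ i, IndepFun (fun ω => φ fun t => W t ω i) (fun ω => ψ fun t => W t ω i) μ) :
    IndepFun (fun ω i => φ fun t => W t ω i) (fun ω i => ψ fun t => W t ω i) μ := by
  have hm : ∀ i, Measurable fun ω t => W t ω i := fun i => by
    have := hW.measurable
    fun_prop
  refine indepFun_pi_of_iIndepFun_prodMk (fun i => hφ.comp (hm i)) (fun i => hψ.comp (hm i)) ?_ h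
  exact hW.indep.comp (fun _ w => (φ w, ψ w)) (fun _ => hφ.prodMk hψ)

/-- The normalized increment of the noise over the interval `[k h, (k + 1) h]`. -/
noncomputable def normIncr (h : ℝ) (k : ℕ) (w : ℝ≥0 → EuclideanSpace ℝ (Fin d)) (i : Fin d) : ℝ :=
  (√h)⁻¹ * (w (sampleTime h (k + 1)) i - w (sampleTime h k) i)

lemma measurable_normIncr (h : ℝ) (k : ℕ) : Measurable (normIncr (d := d) h k) := by
  unfold normIncr
  fun_prop

lemma IsStdBrownian.indepFun_bridge [IsProbabilityMeasure μ] (hW : IsStdBrownian μ W) {h : ℝ}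
    (hh : 0 < h) (k : ℕ) :
    IndepFun (fun ω => bridge h k fun t => W t ω) (fun ω => normIncr h k fun t => W t ω) μ := by
  have h1 := hW.indepFun_coord (φ := bridge h k)
    (ψ := fun w => w (sampleTime h (k + 1)) - w (sampleTime h k))
    (by unfold bridge; fun_prop) (by fun_prop) fun i => indepFun_bridge_real (hW.coord i) hh k
  exact h1.comp (φ := fun v s => WithLp.toLp 2 fun i => v i s) (ψ := fun x i => (√h)⁻¹ * x i)
    (by fun_prop) (by fun_prop)

/-- The normalized increments are standard Gaussian. -/
lemma IsStdBrownian.hasLaw_normIncr [IsProbabilityMeasure μ] (hW : IsStdBrownian μ W) {h : ℝ}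
    (hh : 0 < h) (k : ℕ) :
    iIndepFun (fun i ω => normIncr h k (fun t => W t ω) i) μ ∧
      ∀ i, μ.map (fun ω => normIncr h k (fun t => W t ω) i) = gaussianReal 0 1 := by
  constructor
  · exact hW.indep.comp
      (fun _ w => (√h)⁻¹ * (w (sampleTime h (k + 1)) - w (sampleTime h k))) (fun _ => by fun_prop)
  · intro i
    have h1 := (hW.coord i).hasLaw_sub (sampleTime h (k + 1)) (sampleTime h k)
    have h2 := gaussianReal_const_mul h1 (√h)⁻¹
    refine h2.map_eq.trans ?_
    congr 1
    · simp
    · ext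
      have : (dist (sampleTime h (k + 1) : ℝ) (sampleTime h k : ℝ)) = h := by
        rw [coe_sampleTime hh, coe_sampleTime hh, Real.dist_eq]
        push_cast
        rw [show ((k : ℝ) + 1) * h - k * h = h by ring, abs_of_pos hh]
      simp only [inv_pow, Real.sq_sqrt hh.le, NNReal.coe_mul, coe_nndist, NNReal.coe_one]
      exact (congrArg (fun y => h⁻¹ * y) this).trans (inv_mul_cancel₀ hh.ne')

/-- The noise after a sampling time is independent of the noise up to that time. -/
lemma IsStdBrownian.indepFun_incr [IsProbabilityMeasure μ] (hW : IsStdBrownian μ W) (h : ℝ) (k : ℕ) :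
    IndepFun (fun ω s => W (min s (sampleTime h k)) ω) (fun ω => incr h k fun t => W t ω) μ := by
  have h1 := hW.indepFun_coord (φ := fun w s => w (min s (sampleTime h k)))
    (ψ := incr h k) (by fun_prop) (by unfold incr; fun_prop) fun i => by
      have := ((hW.coord i).indepFun_shift (sampleTime h k)).symm
      exact this.comp (φ := fun v s => v ⟨min s (sampleTime h k), mem_Iic.2 (min_le_right _ _)⟩)
        (ψ := id) (by fun_prop) measurable_id
  exact h1.comp (φ := fun v s => WithLp.toLp 2 fun i => v i s)
    (ψ := fun v s => WithLp.toLp 2 fun i => v i s) (by fun_prop) (by fun_prop)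

end Brownian

/-! ### The noise of one sampling interval is sub-Gaussian -/

section NoiseTail

variable {Ω : Type*} [MeasurableSpace Ω] {μ : Measure Ω} {d : ℕ}
  {W : ℝ≥0 → Ω → EuclideanSpace ℝ (Fin d)}

lemma abs_entry_le_norm {p : ℕ} (M : Matrix (Fin d) (Fin p) ℝ) (i : Fin d) (j : Fin p) :
    |M i j| ≤ ‖M‖ := by
  have h1 := Matrix.l2_opNorm_mulVec M (EuclideanSpace.single j 1)
  rw [PiLp.norm_single, norm_one, mul_one] at h1
  refine le_trans ?_ h1
  have h2 := PiLp.norm_apply_le (WithLp.toLp 2 (M.mulVec (EuclideanSpace.single j (1 : ℝ)))) i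
  simpa using h2

lemma IsStdBrownian.hasSubgaussianMGF_incr [IsProbabilityMeasure μ] (hW : IsStdBrownian μ W)
    {h : ℝ} (k : ℕ) {s : ℝ≥0} (hs : s ≤ h.toNNReal) (j : Fin d) :
    HasSubgaussianMGF (fun ω => incr h k (fun t => W t ω) s j) (NNReal.sqrt h.toNNReal ^ 2) μ := by
  rw [NNReal.sq_sqrt]
  exact hasSubgaussianMGF_mono
    (hasSubgaussianMGF_of_hasLaw (((hW.coord j).shift (sampleTime h k)).hasLaw_eval s)) hs

/-- Each coordinate of the noise that enters during a sampling interval is sub-Gaussian with variance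
proxy `(1 + d)² h`, as a limit of linear combinations of Gaussian variables. -/
lemma IsStdBrownian.hasSubgaussianMGF_pathNoise [NeZero d] [IsProbabilityMeasure μ]
    (hW : IsStdBrownian μ W) {h : ℝ} (hh : 0 < h) {A : Matrix (Fin d) (Fin d) ℝ}
    (hA : h * ‖A‖ ≤ 1 / 15) (k : ℕ) (i : Fin d) :
    HasSubgaussianMGF (fun ω => pathNoise h A (incr h k fun t => W t ω) i)
      (((1 + d) * NNReal.sqrt h.toNNReal) ^ 2) μ := by
  set σ := NNReal.sqrt h.toNNReal
  set v : Ω → ℝ≥0 → EuclideanSpace ℝ (Fin d) := fun ω => incr h k fun t => W t ω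
  have hr : ∀ n, HasSubgaussianMGF
      (fun ω => riemannSum h (fun s => noiseKernel h A s (v ω s.toNNReal)) n i) ((d * σ) ^ 2) μ := by
    intro n
    set τ : ℝ := h / (n + 1)
    have hτ : 0 < τ := by positivity
    have hτn : (n + 1) * τ = h := mul_div_cancel₀ _ (by positivity)
    set M : ℕ → Matrix (Fin d) (Fin d) ℝ := fun m => NormedSpace.exp ((h - m * τ) • A) * A
    have hexp : (fun ω => riemannSum h (fun s => noiseKernel h A s (v ω s.toNNReal)) n i) =
        fun ω => ∑ m ∈ Finset.range (n + 1), ∑ j, (τ * M m i j) * v ω (m * τ).toNNReal j := by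
      ext ω
      rw [riemannSum, WithLp.ofLp_sum, Finset.sum_apply]
      refine Finset.sum_congr rfl fun m _ => ?_
      rw [PiLp.smul_apply, noiseKernel, matCLM_apply, Matrix.toLpLin_apply]
      simp only [Matrix.mulVec, dotProduct, smul_eq_mul, Finset.mul_sum, mul_assoc]
      rfl
    rw [hexp]
    set ρ : ℝ≥0 := (τ * (2 * ‖A‖)).toNNReal
    have hρ : (ρ : ℝ) = τ * (2 * ‖A‖) := Real.coe_toNNReal _ (by positivity)
    have hsum := hasSubgaussianMGF_sum (μ := μ) (Finset.range (n + 1))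
      (X := fun m ω => ∑ j, (τ * M m i j) * v ω (m * τ).toNNReal j)
      (σ := fun _ => ∑ _j : Fin d, ρ * σ) ?_
    · refine hasSubgaussianMGF_mono hsum ?_
      gcongr
      rw [← NNReal.coe_le_coe]
      push_cast
      simp only [Finset.sum_const, Finset.card_univ, Fintype.card_fin, Finset.card_range,
        nsmul_eq_mul, hρ]
      push_cast
      calc ((n : ℝ) + 1) * (d * (τ * (2 * ‖A‖) * σ))
          = (2 * (((n : ℝ) + 1) * τ * ‖A‖)) * (d * σ) := by ring
        _ ≤ 1 * (d * σ) := by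
            rw [hτn]
            gcongr
            linarith
        _ = d * σ := one_mul _
    · intro m hm
      have hm' : (m : ℝ) + 1 ≤ n + 1 := by
        have := Finset.mem_range.1 hm
        exact_mod_cast this
      have hmh : m * τ ≤ h := by rw [← hτn]; gcongr; linarith
      refine hasSubgaussianMGF_sum Finset.univ fun j _ => ?_
      refine hasSubgaussianMGF_mul_sq
        (hW.hasSubgaussianMGF_incr k (Real.toNNReal_le_toNNReal hmh) j) ?_
      rw [hρ, abs_mul, abs_of_pos hτ]
      gcongr
      exact (abs_entry_le_norm _ i j).trans (norm_noiseMatrix_le hA (by positivity) hmh)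
  have hadd : ∀ n, HasSubgaussianMGF (fun ω => v ω h.toNNReal i +
      riemannSum h (fun s => noiseKernel h A s (v ω s.toNNReal)) n i)
      (((1 + d) * σ) ^ 2) μ := by
    intro n
    have := (hW.hasSubgaussianMGF_incr (h := h) k le_rfl i).add (hr n)
    simp only [NNReal.sqrt_sq] at this
    rwa [add_mul, one_mul]
  refine hasSubgaussianMGF_of_tendsto hadd ?_
  filter_upwards [hW.ae_continuous] with ω hω
  have hv : Continuous (v ω) := continuous_incr hω
  have hc : Continuous fun s : ℝ => noiseKernel h A s (v ω s.toNNReal) :=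
    (continuous_noiseKernel h A).clm_apply (hv.comp continuous_real_toNNReal)
  have h1 := tendsto_riemannSum hh hc
  have h2 := ((PiLp.continuous_apply 2 (fun _ : Fin d => ℝ) i).tendsto _).comp h1
  have h3 : pathNoise h A (v ω) i = v ω h.toNNReal i +
      (∫ s in (0 : ℝ)..h, noiseKernel h A s (v ω s.toNNReal)) i := by
    rw [pathNoise_eq hh A hv]
    rfl
  rw [h3]
  exact h2.const_add _

end NoiseTail

/-! ### Columns of the regression matrix -/

section Columns

variable {Ω : Type*} [MeasurableSpace Ω] {μ : Measure Ω}

/-- The law of a standard Gaussian vector split into two independent blocks. -/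
lemma map_sumElim_eq_pi [IsProbabilityMeasure μ] {ι κ : Type*} [Fintype ι] [Fintype κ]
    {G : Ω → ι → ℝ} {V : Ω → κ → ℝ} (hG : Measurable G) (hV : Measurable V)
    (hGl : μ.map G = Measure.pi fun _ => gaussianReal 0 1)
    (hVl : μ.map V = Measure.pi fun _ => gaussianReal 0 1) (h : IndepFun G V μ) :
    μ.map (fun ω => Sum.elim (G ω) (V ω)) = Measure.pi fun _ : ι ⊕ κ => gaussianReal 0 1 := by
  rw [indepFun_iff_map_prod_eq_prod_map_map hG.aemeasurable hV.aemeasurable, hGl, hVl] at h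
  rw [← (measurePreserving_sumPiEquivProdPi_symm
    (fun _ : ι ⊕ κ => gaussianReal 0 1)).map_eq, ← h,
    Measure.map_map (MeasurableEquiv.measurable _) (hG.prodMk hV)]
  congr 1

lemma iIndepFun_of_map_eq_pi [IsProbabilityMeasure μ] {ι : Type*} [Fintype ι] {G : Ω → ι → ℝ}
    (hG : Measurable G) (hl : μ.map G = Measure.pi fun _ => gaussianReal 0 1) :
    iIndepFun (fun i ω => G ω i) μ ∧ ∀ i, μ.map (fun ω => G ω i) = gaussianReal 0 1 := by
  have hm : ∀ i, μ.map (fun ω => G ω i) = gaussianReal 0 1 := by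
    intro i
    have : (fun ω => G ω i) = Function.eval i ∘ G := rfl
    rw [this, ← Measure.map_map (measurable_pi_apply i) hG, hl]
    exact (measurePreserving_eval (fun _ : ι => gaussianReal 0 1) i).map_eq
  refine ⟨?_, hm⟩
  rw [iIndepFun_iff_map_fun_eq_pi_map (fun i => by fun_prop)]
  simp_rw [hm]
  exact hl

/-- With high probability all columns of the regression matrix are far from the span of the other
columns, so that a linear combination of the columns is not shorter than its coefficients. The rows
are `g l + a l`, where `g l` is a standard Gaussian vector independent of `a l`, whose law is
arbitrary: the `j`-th column of `a` is added to the vectors spanning the subspace that the `j`-th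
column of `g` has to avoid. -/
lemma measure_norm_sum_columns_lt [IsProbabilityMeasure μ] {H : ℕ} {J : Type*} [Fintype J]
    [DecidableEq J] {a g : Fin H → Ω → J → ℝ} (ha : ∀ l, Measurable (a l))
    (hg : ∀ l, Measurable (g l)) (hind : iIndepFun (fun l ω => (a l ω, g l ω)) μ)
    (hag : ∀ l, IndepFun (a l) (g l) μ)
    (hlaw : ∀ l, μ.map (g l) = Measure.pi fun _ => gaussianReal 0 1)
    {r : ℝ} (hr : r ^ 2 ≤ ((H : ℝ) - Fintype.card J) / 4) :
    μ {ω | ∃ (θ : J → ℝ) (j : J),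
        ‖∑ i, θ i • WithLp.toLp 2 (fun l => g l ω i + a l ω i)‖ < |θ j| * r} ≤
      ENNReal.ofReal (Fintype.card J * Real.exp (-((H : ℝ) - Fintype.card J) / 4)) := by
  set q : J → Ω → J → EuclideanSpace ℝ (Fin H) := fun j ω i =>
    WithLp.toLp 2 (fun l => if i = j then a l ω i else g l ω i + a l ω i)
  set γ : J → Ω → EuclideanSpace ℝ (Fin H) := fun j ω => WithLp.toLp 2 (fun l => g l ω j)
  have hgj : ∀ l j, Measurable fun ω => g l ω j := fun l j => (measurable_pi_apply j).comp (hg l)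
  have haj : ∀ l j, Measurable fun ω => a l ω j := fun l j => (measurable_pi_apply j).comp (ha l)
  have hγ : ∀ j, Measurable (γ j) := fun j => by fun_prop
  have hq : ∀ j, Measurable (q j) := by
    intro j
    refine measurable_pi_lambda _ fun i => (WithLp.measurable_toLp 2 _).comp ?_
    refine measurable_pi_lambda _ fun l => ?_
    split_ifs
    · exact haj l i
    · exact (hgj l i).add (haj l i)
  have hγlaw : ∀ j, μ.map (γ j) = stdGaussian (EuclideanSpace ℝ (Fin H)) := by
    intro j
    have h1 : iIndepFun (fun l ω => g l ω j) μ :=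
      hind.comp (fun _ x => x.2 j) (fun _ => by fun_prop)
    have h2 := h1.map_fun_eq_pi_map fun l => (hgj l j).aemeasurable
    simp_rw [fun l => (iIndepFun_of_map_eq_pi (hg l) (hlaw l)).2 j] at h2
    rw [← map_pi_eq_stdGaussian, ← h2,
      Measure.map_map (WithLp.measurable_toLp 2 _) (measurable_pi_lambda _ fun l => hgj l j)]
    rfl
  have hqγ : ∀ j, IndepFun (q j) (γ j) μ := by
    intro j
    set o : Fin H → Ω → {i // i ≠ j} → ℝ := fun l ω i => g l ω i
    have ho : ∀ l, Measurable (o l) := fun l => by fun_prop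
    have h1 : ∀ l, IndepFun (fun ω => (a l ω, o l ω)) (fun ω => g l ω j) μ := by
      intro l
      refine indepFun_prodMk_left (ha l) (ho l) (hgj l j) ?_ ?_
      · exact (hag l).comp (ψ := fun x => ((fun i : {i // i ≠ j} => x i), x j)) measurable_id
          (by fun_prop)
      · have h2 := (iIndepFun_of_map_eq_pi (hg l) (hlaw l)).1.indepFun_finset
          (Finset.univ.filter (· ≠ j)) {j} (by simp) (fun i => hgj l i)
        exact h2.comp 
          (φ := fun (x : (Finset.univ.filter (· ≠ j) : Finset J) → ℝ) (i : {i // i ≠ j}) =>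
            x ⟨i, by simp [i.2]⟩)
          (ψ := fun (x : ({j} : Finset J) → ℝ) => x ⟨j, by simp⟩) (by fun_prop) (by fun_prop)
    have h3 : iIndepFun (fun l ω => ((a l ω, o l ω), g l ω j)) μ :=
      hind.comp (fun _ x => ((x.1, fun i : {i // i ≠ j} => x.2 i), x.2 j)) (fun _ => by fun_prop)
    have h4 := indepFun_pi_of_iIndepFun_prodMk (fun l => (ha l).prodMk (ho l))
      (fun l => hgj l j) h3 h1
    have h5 := h4.comp (φ := fun x i => WithLp.toLp 2 (fun l => if hi : i = j then (x l).1 i else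
      (x l).2 ⟨i, hi⟩ + (x l).1 i)) (ψ := WithLp.toLp 2) (by
        refine measurable_pi_lambda _ fun i => (WithLp.measurable_toLp 2 _).comp ?_
        refine measurable_pi_lambda _ fun l => ?_
        split_ifs <;> fun_prop) (WithLp.measurable_toLp 2 _)
    exact h5
  have hsub : {ω | ∃ (θ : J → ℝ) (j : J),
      ‖∑ i, θ i • WithLp.toLp 2 (fun l => g l ω i + a l ω i)‖ < |θ j| * r} ⊆
      ⋃ j, {ω | ∃ c : J → ℝ, ‖γ j ω - ∑ i, c i • q j ω i‖ < r} := by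
    rintro ω ⟨θ, j, hlt⟩
    rw [mem_iUnion]
    have hθ : θ j ≠ 0 := by
      intro h0
      rw [h0, abs_zero, zero_mul] at hlt
      exact absurd hlt (not_lt.2 (norm_nonneg _))
    refine ⟨j, fun i => if i = j then -1 else -(θ i / θ j), ?_⟩
    have h1 : ∑ i, θ i • WithLp.toLp 2 (fun l => g l ω i + a l ω i) =
        θ j • (γ j ω - ∑ i, (if i = j then -1 else -(θ i / θ j)) • q j ω i) := by
      ext l
      simp only [WithLp.ofLp_sum, Finset.sum_apply, WithLp.ofLp_smul, Pi.smul_apply, smul_eq_mul,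
        WithLp.ofLp_sub, Pi.sub_apply, γ, q, mul_sub, Finset.mul_sum]
      rw [← Finset.add_sum_erase _ _ (Finset.mem_univ j),
        ← Finset.add_sum_erase _ (fun i => θ j * _) (Finset.mem_univ j)]
      have h2 : ∀ i ∈ Finset.univ.erase j, θ j * ((if i = j then -1 else -(θ i / θ j)) *
          if i = j then a l ω i else g l ω i + a l ω i) = -(θ i * (g l ω i + a l ω i)) := by
        intro i hi
        rw [if_neg (Finset.ne_of_mem_erase hi), if_neg (Finset.ne_of_mem_erase hi)]
        field_simp
      rw [Finset.sum_congr rfl h2, Finset.sum_neg_distrib]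
      simp only [if_true]
      ring
    rw [h1, norm_smul, Real.norm_eq_abs] at hlt
    exact lt_of_mul_lt_mul_left hlt (abs_nonneg _)
  calc _ ≤ _ := measure_mono hsub
    _ ≤ ∑ j, μ _ := measure_iUnion_fintype_le _ _
    _ ≤ ∑ _j : J, ENNReal.ofReal (Real.exp (-((H : ℝ) - Fintype.card J) / 4)) :=
        Finset.sum_le_sum fun j _ => measure_dist_span_lt (hq j) (hγ j) (hγlaw j) (hqγ j) hr
    _ = _ := by
        rw [Finset.sum_const, Finset.card_univ, nsmul_eq_mul, ← ENNReal.ofReal_natCast,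
          ← ENNReal.ofReal_mul (by positivity)]

/-- With high probability every column of the noise has a small projection onto the span of the
columns of the regression matrix. -/
lemma measure_inner_columns_gt [IsProbabilityMeasure μ] {H d : ℕ} {J : Type*} [Fintype J]
    {z : Fin H → Ω → J → ℝ} {w : Fin H → Ω → EuclideanSpace ℝ (Fin d)}
    (hz : ∀ l, Measurable (z l)) (hw : ∀ l, Measurable (w l))
    (hind : iIndepFun (fun l ω => (z l ω, w l ω)) μ) (hzw : ∀ l, IndepFun (z l) (w l) μ)
    {c : ℝ≥0} (hsub : ∀ l i, HasSubgaussianMGF (fun ω => w l ω i) c μ) {t : ℝ} (ht : 0 ≤ t) :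
    μ {ω | ∃ (i : Fin d) (θ : J → ℝ),
        Fintype.card J * t * ‖∑ j, θ j • WithLp.toLp 2 (fun l => z l ω j)‖ <
        inner ℝ (∑ j, θ j • WithLp.toLp 2 (fun l => z l ω j))
          (WithLp.toLp 2 (fun l => w l ω i))} ≤
      ENNReal.ofReal (d * (2 * Fintype.card J * Real.exp (-t ^ 2 / (2 * c)))) := by
  have h1 := indepFun_pi_of_iIndepFun_prodMk hz hw hind hzw
  have key : ∀ i : Fin d, μ {ω | ∃ θ : J → ℝ,
        Fintype.card J * t * ‖∑ j, θ j • WithLp.toLp 2 (fun l => z l ω j)‖ <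
        inner ℝ (∑ j, θ j • WithLp.toLp 2 (fun l => z l ω j))
          (WithLp.toLp 2 (fun l => w l ω i))} ≤
      ENNReal.ofReal (2 * Fintype.card J * Real.exp (-t ^ 2 / (2 * c))) := by
    intro i
    refine measure_inner_span_gt (z := fun ω j => WithLp.toLp 2 (fun l => z l ω j))
      (w := fun ω => WithLp.toLp 2 (fun l => w l ω i)) (by fun_prop) (by fun_prop) ?_ ?_
      (fun l => hsub l i) ht
    · exact h1.comp (φ := fun x j => WithLp.toLp 2 (fun l => x l j))
        (ψ := fun x => WithLp.toLp 2 (fun l => x l i)) (by fun_prop) (by fun_prop)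
    · exact hind.comp (fun _ x => x.2 i) (fun _ => by fun_prop)
  rw [ofPred_exists]
  calc _ ≤ ∑ i, μ _ := measure_iUnion_fintype_le _ _
    _ ≤ ∑ _i : Fin d, ENNReal.ofReal (2 * Fintype.card J * Real.exp (-t ^ 2 / (2 * c))) :=
        Finset.sum_le_sum fun i _ => key i
    _ = _ := by
        rw [Finset.sum_const, Finset.card_univ, nsmul_eq_mul, ← ENNReal.ofReal_natCast,
          ← ENNReal.ofReal_mul (by positivity), Fintype.card_fin]

end Columns

/-! ### The least-squares estimate, deterministically -/

section LeastSquares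

variable {d p H : ℕ}

/-- The spectral norm is at most the number of entries times a bound for their absolute values. -/
lemma norm_le_of_abs_entry_le {m n : ℕ} (M : Matrix (Fin m) (Fin n) ℝ) {β : ℝ}
    (hM : ∀ i j, |M i j| ≤ β) : ‖M‖ ≤ m * n * β := by
  classical
  have h1 : M = ∑ i, ∑ j, M i j • Matrix.single i j (1 : ℝ) := by
    simp only [Matrix.smul_single, smul_eq_mul, mul_one]
    exact Matrix.matrix_eq_sum_single M
  have h2 : ∀ (i : Fin m) (j : Fin n), ‖(Matrix.single i j (1 : ℝ) : Matrix (Fin m) (Fin n) ℝ)‖ ≤ 1 := by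
    intro i j
    rw [Matrix.l2_opNorm_def]
    refine ContinuousLinearMap.opNorm_le_bound _ zero_le_one fun x => ?_
    have : (Matrix.toEuclideanLin (Matrix.single i j (1 : ℝ))) x =
        EuclideanSpace.single i (x j) := by
      ext k
      simp [Matrix.toLpLin_apply, Matrix.single_mulVec, Function.update_apply]
    rw [one_mul]
    change ‖(Matrix.toEuclideanLin (Matrix.single i j (1 : ℝ))) x‖ ≤ _
    rw [this, PiLp.norm_single]
    exact PiLp.norm_apply_le x j
  calc ‖M‖ = ‖∑ i, ∑ j, M i j • Matrix.single i j (1 : ℝ)‖ := by rw [← h1]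
    _ ≤ ∑ _i : Fin m, ∑ _j : Fin n, β := by
        refine norm_sum_le_of_le _ fun i _ => norm_sum_le_of_le _ fun j _ => ?_
        rw [norm_smul, Real.norm_eq_abs]
        exact (mul_le_of_le_one_right (abs_nonneg _) (h2 i j)).trans (hM i j)
    _ = m * n * β := by simp; ring

lemma sum_norm_sq_eq_sum_columns (f : Fin H → EuclideanSpace ℝ (Fin d)) :
    ∑ l, ‖f l‖ ^ 2 = ∑ i, ‖WithLp.toLp 2 (fun l => f l i)‖ ^ 2 := by
  simp only [EuclideanSpace.norm_sq_eq, Real.norm_eq_abs, sq_abs]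
  exact Finset.sum_comm

/-- A sum of squares that is at most a multiple of the sum bounds every term. -/
lemma le_of_sum_sq_le {s : Fin d → ℝ} {b : ℝ} (hb : 0 ≤ b)
    (h : ∑ i, s i ^ 2 ≤ 2 * b * ∑ i, s i) (i : Fin d) : s i ≤ b * (1 + d) := by
  have h1 : ∑ j, (s j - b) ^ 2 ≤ d * b ^ 2 := by
    have : ∑ j, (s j - b) ^ 2 = ∑ j, s j ^ 2 - 2 * b * ∑ j, s j + d * b ^ 2 := by
      simp only [sub_sq, Finset.sum_add_distrib, Finset.sum_sub_distrib, Finset.sum_const,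
        Finset.card_univ, Fintype.card_fin, nsmul_eq_mul, Finset.mul_sum]
      congr 2
      exact Finset.sum_congr rfl fun j _ => by ring
    linarith
  have h2 : (s i - b) ^ 2 ≤ d * b ^ 2 :=
    (Finset.single_le_sum (f := fun j => (s j - b) ^ 2) (fun j _ => sq_nonneg _)
      (Finset.mem_univ i)).trans h1
  have hd : (1 : ℝ) ≤ d := by
    have := i.pos
    exact_mod_cast this
  have h3 : s i - b ≤ d * b := by
    refine abs_le_of_sq_le_sq' ?_ (by positivity) |>.2
    nlinarith [sq_nonneg b, mul_nonneg (sub_nonneg.2 hd) (mul_nonneg (by linarith : (0:ℝ) ≤ d) (sq_nonneg b))]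
  linarith

/-- The basic inequality of least squares. The rows of the regression matrix are `z l`, the
observed states are `Mx z_inl`, and the `i`-th rows of `(M - Φ) Mx` and `N - Γ` together are the
coefficients `θ i` of the error of the `i`-th coordinate in the columns of the regression matrix. If the
projection of the noise onto the column space is small and no combination of the columns is
short, then the least-squares solution is close to the truth. -/
lemma abs_entry_le_of_isLeastSquares {z : Fin H → Fin d ⊕ Fin p → ℝ}
    {w : Fin H → EuclideanSpace ℝ (Fin d)} {Φ Mx M : Matrix (Fin d) (Fin d) ℝ}
    {Γ N : Matrix (Fin d) (Fin p) ℝ} {x y : Fin H → EuclideanSpace ℝ (Fin d)}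
    {v : Fin H → EuclideanSpace ℝ (Fin p)}
    (hx : ∀ l, x l = Matrix.toEuclideanLin Mx (WithLp.toLp 2 fun i => z l (Sum.inl i)))
    (hv : ∀ l, v l = WithLp.toLp 2 fun k => z l (Sum.inr k))
    (hy : ∀ l, y l = Matrix.toEuclideanLin Φ (x l) + Matrix.toEuclideanLin Γ (v l) + w l)
    {r τ : ℝ} (hr : 0 < r) (hτ : 0 ≤ τ)
    (hlow : ∀ (θ : Fin d ⊕ Fin p → ℝ) (j : Fin d ⊕ Fin p),
      |θ j| * r ≤ ‖∑ i, θ i • WithLp.toLp 2 (fun l => z l i)‖)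
    (hup : ∀ (i : Fin d) (θ : Fin d ⊕ Fin p → ℝ),
      inner ℝ (∑ j, θ j • WithLp.toLp 2 (fun l => z l j)) (WithLp.toLp 2 (fun l => w l i)) ≤
        τ * ‖∑ j, θ j • WithLp.toLp 2 (fun l => z l j)‖)
    (hLS : IsLeastSquares x v y M N) :
    (∀ i j, |((M - Φ) * Mx) i j| ≤ τ * (1 + d) / r) ∧ ∀ i k, |(N - Γ) i k| ≤ τ * (1 + d) / r := by
  set θ : Fin d → Fin d ⊕ Fin p → ℝ := fun i => Sum.elim (((M - Φ) * Mx) i) ((N - Γ) i)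
  set q : Fin d → EuclideanSpace ℝ (Fin H) := fun i => ∑ j, θ i j • WithLp.toLp 2 (fun l => z l j)
  have hcol : ∀ i l, q i l = (Matrix.toEuclideanLin (M - Φ) (x l) +
      Matrix.toEuclideanLin (N - Γ) (v l)) i := by
    intro i l
    rw [hx, hv, ← toEuclideanLin_mul_apply]
    simp only [q, WithLp.ofLp_sum, Finset.sum_apply, PiLp.smul_apply, smul_eq_mul,
      Fintype.sum_sum_type, θ, Sum.elim_inl, Sum.elim_inr, Matrix.toLpLin_apply, PiLp.add_apply,
      Matrix.mulVec, dotProduct]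
  have hloss : ∑ l, ‖w l - (Matrix.toEuclideanLin (M - Φ) (x l) +
      Matrix.toEuclideanLin (N - Γ) (v l))‖ ^ 2 ≤ ∑ l, ‖w l‖ ^ 2 := by
    have h1 := hLS Φ Γ
    simp only [lsLoss] at h1
    have h2 : ∀ l, y l - Matrix.toEuclideanLin M (x l) - Matrix.toEuclideanLin N (v l) =
        w l - (Matrix.toEuclideanLin (M - Φ) (x l) + Matrix.toEuclideanLin (N - Γ) (v l)) := by
      intro l
      rw [hy, map_sub, map_sub, LinearMap.sub_apply, LinearMap.sub_apply]
      abel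
    have h3 : ∀ l, y l - Matrix.toEuclideanLin Φ (x l) - Matrix.toEuclideanLin Γ (v l) = w l := by
      intro l
      rw [hy]
      abel
    simp only [h2, h3] at h1
    linarith
  rw [sum_norm_sq_eq_sum_columns, sum_norm_sq_eq_sum_columns w] at hloss
  have h4 : ∀ i, WithLp.toLp 2 (fun l => (w l - (Matrix.toEuclideanLin (M - Φ) (x l) +
      Matrix.toEuclideanLin (N - Γ) (v l))) i) = WithLp.toLp 2 (fun l => w l i) - q i := by
    intro i
    ext l
    simp [hcol]
  simp only [h4, norm_sub_sq_real, Finset.sum_add_distrib, Finset.sum_sub_distrib] at hloss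
  have h5 : ∑ i, ‖q i‖ ^ 2 ≤ 2 * τ * ∑ i, ‖q i‖ := by
    have h6 : ∑ i, 2 * inner ℝ (WithLp.toLp 2 (fun l => w l i)) (q i) ≤
        ∑ i, 2 * (τ * ‖q i‖) := by
      refine Finset.sum_le_sum fun i _ => ?_
      rw [real_inner_comm]
      exact mul_le_mul_of_nonneg_left (hup i (θ i)) zero_le_two
    rw [← Finset.mul_sum, ← Finset.mul_sum, ← Finset.mul_sum] at h6
    rw [← Finset.mul_sum] at hloss
    linarith
  have h7 : ∀ i j, |θ i j| ≤ τ * (1 + d) / r := by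
    intro i j
    rw [le_div_iff₀ hr]
    exact (hlow (θ i) j).trans (le_of_sum_sq_le hτ h5 i)
  exact ⟨fun i j => h7 i (Sum.inl j), fun i k => h7 i (Sum.inr k)⟩

/-- Right multiplication by a matrix close to the identity can be undone. -/
lemma norm_le_of_norm_mul_le [NeZero d] {Y G : Matrix (Fin d) (Fin d) ℝ} (hG : ‖G - 1‖ ≤ 1 / 4) :
    ‖Y‖ ≤ 2 * ‖Y * G‖ := by
  have h1 : Y = Y * G - Y * (G - 1) := by rw [Matrix.mul_sub, Matrix.mul_one]; abel
  have h2 : ‖Y * (G - 1)‖ ≤ ‖Y‖ * (1 / 4) :=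
    (norm_mul_le _ _).trans (mul_le_mul_of_nonneg_left hG (norm_nonneg _))
  have h3 : ‖Y‖ ≤ ‖Y * G‖ + ‖Y * (G - 1)‖ := by
    conv_lhs => rw [h1]
    exact norm_sub_le _ _
  linarith [norm_nonneg Y, norm_nonneg (Y * G)]

end LeastSquares

/-! ### The regression design of one trajectory -/

section Trajectory

variable {d p : ℕ}

/-- All inputs but the last one, extended by `0`. -/
noncomputable def pastInput {m : ℕ} (u : Fin (m + 2) → EuclideanSpace ℝ (Fin p)) (k : ℕ) :
    EuclideanSpace ℝ (Fin p) :=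
  if hk : k < m + 1 then u ⟨k, by omega⟩ else 0

/-- The Gaussian part of the regression vector of a trajectory: the normalized increment of the noise
over the sampling interval before the state is observed, and the input applied afterwards. -/
noncomputable def designNoise (h : ℝ) {m : ℕ} (u : Fin (m + 2) → EuclideanSpace ℝ (Fin p))
    (w : ℝ≥0 → EuclideanSpace ℝ (Fin d)) : Fin d ⊕ Fin p → ℝ :=
  Sum.elim (normIncr h m w) (u (Fin.last (m + 1)))

/-- The remaining part of the regression vector: the state that is reached with the bridge in place of
the noise, in the coordinates in which the increment of the noise is a standard Gaussian vector. -/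
noncomputable def designShift (h : ℝ) (A : Matrix (Fin d) (Fin d) ℝ) (B : Matrix (Fin d) (Fin p) ℝ)
    {m : ℕ} (x₀ : EuclideanSpace ℝ (Fin d)) (u : Fin (m + 2) → EuclideanSpace ℝ (Fin p))
    (w : ℝ≥0 → EuclideanSpace ℝ (Fin d)) : Fin d ⊕ Fin p → ℝ :=
  Sum.elim (Matrix.toEuclideanLin ((√h)⁻¹ • (bridgeGain h A)⁻¹)
    (stateMap h A B x₀ (pastInput u) (bridge h m w) (m + 1))) 0

lemma measurable_pastInput (m : ℕ) : Measurable (pastInput (p := p) (m := m)) := by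
  refine measurable_pi_lambda _ fun k => ?_
  unfold pastInput
  split_ifs
  · exact measurable_pi_apply _
  · exact measurable_const

lemma measurable_sumElim {ι κ : Type*} :
    Measurable fun q : (ι → ℝ) × (κ → ℝ) => Sum.elim q.1 q.2 := by
  refine measurable_pi_lambda _ ?_
  rintro (i | k)
  · exact (measurable_pi_apply i).comp measurable_fst
  · exact (measurable_pi_apply k).comp measurable_snd

lemma measurable_designNoise (h : ℝ) (m : ℕ) :
    Measurable fun q : (Fin (m + 2) → EuclideanSpace ℝ (Fin p)) ×
      (ℝ≥0 → EuclideanSpace ℝ (Fin d)) => designNoise h q.1 q.2 :=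
  measurable_sumElim.comp (((measurable_normIncr h m).comp measurable_snd).prodMk (by fun_prop))

lemma measurable_designShift (h : ℝ) (A : Matrix (Fin d) (Fin d) ℝ) (B : Matrix (Fin d) (Fin p) ℝ)
    (m : ℕ) : Measurable fun q : EuclideanSpace ℝ (Fin d) ×
      (Fin (m + 2) → EuclideanSpace ℝ (Fin p)) × (ℝ≥0 → EuclideanSpace ℝ (Fin d)) =>
        designShift h A B q.1 q.2.1 q.2.2 := by
  have h1 : Measurable fun q : EuclideanSpace ℝ (Fin d) ×
      (Fin (m + 2) → EuclideanSpace ℝ (Fin p)) × (ℝ≥0 → EuclideanSpace ℝ (Fin d)) =>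
        (q.1, pastInput q.2.1, bridge h m q.2.2) :=
    measurable_fst.prodMk (((measurable_pastInput m).comp (measurable_fst.comp measurable_snd)).prodMk
      ((measurable_bridge h m).comp (measurable_snd.comp measurable_snd)))
  have h2 := (measurable_stateMap h A B (m + 1)).comp h1
  have h3 := (measurable_toEuclideanLin ((√h)⁻¹ • (bridgeGain h A)⁻¹)).comp h2
  have h4 := (WithLp.measurable_ofLp 2 _).comp h3
  exact measurable_sumElim.comp (h4.prodMk measurable_const)

lemma min_sampleTime {h : ℝ} (hh : 0 < h) (m : ℕ) :
    min (sampleTime h m) (sampleTime h (m + 1)) = sampleTime h m :=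
  min_eq_left (sampleTime_mono hh (by simp))

/-- The regression vector depends on the noise only up to the time at which the state is observed. -/
lemma design_stopped {h : ℝ} (hh : 0 < h) (A : Matrix (Fin d) (Fin d) ℝ)
    (B : Matrix (Fin d) (Fin p) ℝ) {m : ℕ} (x₀ : EuclideanSpace ℝ (Fin d))
    (u : Fin (m + 2) → EuclideanSpace ℝ (Fin p)) (w : ℝ≥0 → EuclideanSpace ℝ (Fin d)) :
    designNoise h u w + designShift h A B x₀ u w =
      designNoise h u (fun s => w (min s (sampleTime h (m + 1)))) +
        designShift h A B x₀ u (fun s => w (min s (sampleTime h (m + 1)))) := by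
  have h1 : normIncr h m (fun s => w (min s (sampleTime h (m + 1)))) = normIncr h m w := by
    ext i
    simp only [normIncr, min_self, min_sampleTime hh]
  have h2 : bridge h m (fun s => w (min s (sampleTime h (m + 1)))) = bridge h m w := by
    ext s : 1
    simp only [bridge, min_self, min_sampleTime hh, min_assoc]
  rw [designNoise, designNoise, designShift, designShift, h1, h2]

variable [NeZero d]

lemma isUnit_bridgeGain {h : ℝ} (hh : 0 < h) {A : Matrix (Fin d) (Fin d) ℝ}
    (hA : h * ‖A‖ ≤ 1 / 15) : IsUnit (bridgeGain h A) := by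
  have h1 := norm_bridgeGain_sub_one_le hh hA
  refine (isUnit_of_norm_sub_smul_one_le (h := 1) one_pos ?_).1
  rw [one_smul]
  exact h1

/-- The observed state is a fixed linear image of the first block of the regression vector. -/
lemma state_eq_design {h : ℝ} (hh : 0 < h) {A : Matrix (Fin d) (Fin d) ℝ}
    (hA : h * ‖A‖ ≤ 1 / 15) {B : Matrix (Fin d) (Fin p) ℝ} {m : ℕ}
    {u : Fin (m + 2) → EuclideanSpace ℝ (Fin p)} {w x : ℝ≥0 → EuclideanSpace ℝ (Fin d)}
    (hw : Continuous w) (hx : SolvesSDE A B ((m + 2 : ℕ) * h) (holdInput h u) w x) :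
    x (sampleTime h (m + 1)) = Matrix.toEuclideanLin (√h • bridgeGain h A)
      (WithLp.toLp 2 fun i => (designNoise h u w + designShift h A B (x 0) u w) (Sum.inl i)) := by
  have h1 : x (sampleTime h (m + 1)) = stateMap h A B (x 0) (pastInput u) w (m + 1) :=
    eq_stateMap hh hw hx (by omega) fun i hi => by simp [pastInput, hi]
  have hs : √h ≠ 0 := (Real.sqrt_pos.2 hh).ne'
  have h2 : (WithLp.toLp 2 fun i => (designNoise h u w + designShift h A B (x 0) u w) (Sum.inl i) :
      EuclideanSpace ℝ (Fin d)) = (√h)⁻¹ • (w (sampleTime h (m + 1)) - w (sampleTime h m)) +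
      Matrix.toEuclideanLin ((√h)⁻¹ • (bridgeGain h A)⁻¹)
        (stateMap h A B (x 0) (pastInput u) (bridge h m w) (m + 1)) := by
    ext i
    simp [designNoise, designShift, normIncr]
  rw [h1, stateMap_eq_bridge_add hh hw, h2, map_add, ← toEuclideanLin_mul_apply,
    Matrix.smul_mul, Matrix.mul_smul, smul_smul, mul_inv_cancel₀ hs, one_smul,
    Matrix.mul_nonsing_inv _ ((Matrix.isUnit_iff_isUnit_det _).1 (isUnit_bridgeGain hh hA)),
    map_smul, map_smul, LinearMap.smul_apply, smul_smul, inv_mul_cancel₀ hs, one_smul,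
    Matrix.toLpLin_one, LinearMap.id_apply, add_comm]

end Trajectory

section TrajectoryLaw

variable {Ω : Type*} [MeasurableSpace Ω] {μ : Measure Ω} [IsProbabilityMeasure μ] {d p m : ℕ}
  {X₀ : Ω → EuclideanSpace ℝ (Fin d)} {u : Fin (m + 2) → Ω → EuclideanSpace ℝ (Fin p)}
  {W : ℝ≥0 → Ω → EuclideanSpace ℝ (Fin d)} {h : ℝ}

/-- The two parts of the regression vector are independent: the bridge is independent of the
increment, and the past inputs are independent of the last one. -/
lemma indepFun_designShift_designNoise (hh : 0 < h) (A : Matrix (Fin d) (Fin d) ℝ)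
    (B : Matrix (Fin d) (Fin p) ℝ) (hX : Measurable X₀) (hu : ∀ k, Measurable (u k))
    (hW : IsStdBrownian μ W)
    (hXi : IndepFun X₀ (fun ω => ((fun k => u k ω), (fun t => W t ω))) μ)
    (hui : IndepFun (fun ω k => u k ω) (fun ω t => W t ω) μ) (huu : iIndepFun u μ) :
    IndepFun (fun ω => designShift h A B (X₀ ω) (fun k => u k ω) (fun t => W t ω))
      (fun ω => designNoise h (fun k => u k ω) (fun t => W t ω)) μ := by
  have hWp := hW.measurable_path
  have hb : Measurable fun ω => bridge h m fun t => W t ω := (measurable_bridge h m).comp hWp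
  have hn : Measurable fun ω => normIncr h m fun t => W t ω := (measurable_normIncr h m).comp hWp
  have hup : Measurable fun ω k => u k ω := measurable_pi_lambda _ hu
  have hp : Measurable fun ω => pastInput fun k => u k ω := (measurable_pastInput m).comp hup
  -- `pastInput` only uses the inputs other than the last one.
  have h1 : IndepFun (fun ω => pastInput fun k => u k ω) (u (Fin.last (m + 1))) μ := by
    have h2 := huu.indepFun_finset (Finset.univ.filter (· ≠ Fin.last (m + 1)))
      {Fin.last (m + 1)} (by simp) hu
    refine h2.comp
      (φ := fun (x : (Finset.univ.filter (· ≠ Fin.last (m + 1)) : Finset (Fin (m + 2))) →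
        EuclideanSpace ℝ (Fin p)) (k : ℕ) => if hk : k < m + 1 then
          x ⟨⟨k, by omega⟩, by simp [Fin.ext_iff, hk.ne]⟩ else 0)
      (ψ := fun (x : ({Fin.last (m + 1)} : Finset (Fin (m + 2))) → EuclideanSpace ℝ (Fin p)) =>
        x ⟨Fin.last (m + 1), by simp⟩) ?_ (by fun_prop)
    refine measurable_pi_lambda _ fun k => ?_
    split_ifs <;> fun_prop
  have h3 : IndepFun (fun ω => (bridge h m fun t => W t ω, pastInput fun k => u k ω))
      (fun ω => (normIncr h m fun t => W t ω, u (Fin.last (m + 1)) ω)) μ := by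
    refine indepFun_prodMk_prodMk hb hn hp (hu _) ?_ (hW.indepFun_bridge hh m) h1
    exact hui.symm.comp (φ := fun w => (bridge h m w, normIncr h m w))
      (ψ := fun v => (pastInput v, v (Fin.last (m + 1))))
      ((measurable_bridge h m).prodMk (measurable_normIncr h m))
      ((measurable_pastInput m).prodMk (measurable_pi_apply _))
  have hψ : Measurable fun q : (Fin (m + 2) → EuclideanSpace ℝ (Fin p)) ×
      (ℝ≥0 → EuclideanSpace ℝ (Fin d)) =>
        ((bridge h m q.2, pastInput q.1), (normIncr h m q.2, q.1 (Fin.last (m + 1)))) :=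
    (((measurable_bridge h m).comp measurable_snd).prodMk
      ((measurable_pastInput m).comp measurable_fst)).prodMk
      (((measurable_normIncr h m).comp measurable_snd).prodMk
        ((measurable_pi_apply _).comp measurable_fst))
  have h4 := indepFun_prodMk_left hX (hb.prodMk hp) (hn.prodMk (hu _))
    (hXi.comp measurable_id hψ) h3
  have h5 : Measurable fun q : EuclideanSpace ℝ (Fin d) × (ℝ≥0 → EuclideanSpace ℝ (Fin d)) ×
      (ℕ → EuclideanSpace ℝ (Fin p)) => (q.1, q.2.2, q.2.1) := by fun_prop
  have h6 : Measurable fun q : EuclideanSpace ℝ (Fin d) × (ℝ≥0 → EuclideanSpace ℝ (Fin d)) ×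
      (ℕ → EuclideanSpace ℝ (Fin p)) =>
        Sum.elim (Matrix.toEuclideanLin ((√h)⁻¹ • (bridgeGain h A)⁻¹)
          (stateMap h A B q.1 q.2.2 q.2.1 (m + 1))) (0 : Fin p → ℝ) :=
    measurable_sumElim.comp (Measurable.prodMk ((WithLp.measurable_ofLp 2 _).comp
      ((measurable_toEuclideanLin _).comp ((measurable_stateMap h A B (m + 1)).comp h5)))
        measurable_const)
  have h7 : Measurable fun q : (Fin d → ℝ) × EuclideanSpace ℝ (Fin p) =>
      Sum.elim q.1 q.2.ofLp :=
    measurable_sumElim.comp (measurable_fst.prodMk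
      ((WithLp.measurable_ofLp 2 _).comp measurable_snd))
  exact h4.comp h6 h7

/-- The Gaussian part of the regression vector is a standard Gaussian vector. -/
lemma map_designNoise (hh : 0 < h) (hu : ∀ k, Measurable (u k)) (hW : IsStdBrownian μ W)
    (hul : HasLaw (u (Fin.last (m + 1))) (stdGaussian (EuclideanSpace ℝ (Fin p))) μ)
    (hui : IndepFun (fun ω k => u k ω) (fun ω t => W t ω) μ) :
    μ.map (fun ω => designNoise h (fun k => u k ω) (fun t => W t ω)) =
      Measure.pi fun _ => gaussianReal 0 1 := by
  have hn : Measurable fun ω => normIncr h m fun t => W t ω :=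
    (measurable_normIncr h m).comp hW.measurable_path
  refine map_sumElim_eq_pi hn ((WithLp.measurable_ofLp 2 _).comp (hu _)) ?_ ?_ ?_
  · obtain ⟨h1, h2⟩ := hW.hasLaw_normIncr hh m
    have := h1.map_fun_eq_pi_map fun i => (by fun_prop : Measurable _).aemeasurable
    simp_rw [h2] at this
    exact this
  · change μ.map (WithLp.ofLp ∘ u (Fin.last (m + 1))) = _
    rw [← Measure.map_map (WithLp.measurable_ofLp 2 _) (hu _), hul.map_eq, ← map_pi_eq_stdGaussian,
      Measure.map_map (WithLp.measurable_ofLp 2 _) (WithLp.measurable_toLp 2 _)]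
    exact Measure.map_id
  · exact hui.symm.comp (φ := normIncr h m) (ψ := fun v => (v (Fin.last (m + 1))).ofLp)
      (measurable_normIncr h m) (by fun_prop)

/-- The regression vector is independent of the noise that enters afterwards. -/
lemma indepFun_design_pathNoise (hh : 0 < h) (A : Matrix (Fin d) (Fin d) ℝ)
    (B : Matrix (Fin d) (Fin p) ℝ) (hX : Measurable X₀) (hu : ∀ k, Measurable (u k))
    (hW : IsStdBrownian μ W)
    (hXi : IndepFun X₀ (fun ω => ((fun k => u k ω), (fun t => W t ω))) μ)
    (hui : IndepFun (fun ω k => u k ω) (fun ω t => W t ω) μ) :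
    IndepFun (fun ω => designNoise h (fun k => u k ω) (fun t => W t ω) +
        designShift h A B (X₀ ω) (fun k => u k ω) (fun t => W t ω))
      (fun ω => pathNoise h A (incr h (m + 1) fun t => W t ω)) μ := by
  have hWp := hW.measurable_path
  have hup : Measurable fun ω k => u k ω := measurable_pi_lambda _ hu
  set S : Ω → ℝ≥0 → EuclideanSpace ℝ (Fin d) := fun ω s => W (min s (sampleTime h (m + 1))) ω
  have hS : Measurable S := measurable_pi_lambda _ fun s => hW.measurable _
  have hi : Measurable fun ω => incr h (m + 1) fun t => W t ω := (measurable_incr h _).comp hWp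
  have hfun : Measurable fun w : ℝ≥0 → EuclideanSpace ℝ (Fin d) =>
      ((fun s => w (min s (sampleTime h (m + 1)))), incr h (m + 1) w) :=
    Measurable.prodMk (by fun_prop) (measurable_incr h _)
  have h1 : IndepFun (fun ω => ((fun k => u k ω), S ω))
      (fun ω => incr h (m + 1) fun t => W t ω) μ :=
    indepFun_prodMk_left hup hS hi (hui.comp measurable_id hfun) (hW.indepFun_incr h (m + 1))
  have hψ : Measurable fun q : (Fin (m + 2) → EuclideanSpace ℝ (Fin p)) ×
      (ℝ≥0 → EuclideanSpace ℝ (Fin d)) =>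
        ((q.1, fun s => q.2 (min s (sampleTime h (m + 1)))), incr h (m + 1) q.2) :=
    Measurable.prodMk (by fun_prop) ((measurable_incr h _).comp measurable_snd)
  have h2 := indepFun_prodMk_left hX (hup.prodMk hS) hi (hXi.comp measurable_id hψ) h1
  have h3 := h2.comp (φ := fun q => designNoise h q.2.1 q.2.2 + designShift h A B q.1 q.2.1 q.2.2)
    (ψ := pathNoise h A)
    (((measurable_designNoise h m).comp measurable_snd).add (measurable_designShift h A B m))
    (measurable_pathNoise h A)
  simp_rw [fun ω => design_stopped hh A B (X₀ ω) (fun k => u k ω) (fun t => W t ω)]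
  exact h3

end TrajectoryLaw

/-! ### The estimation error of the discrete-time regression -/

section Experiment

variable {Ω : Type*} [MeasurableSpace Ω] {μ : Measure Ω} [IsProbabilityMeasure μ] {d p H m : ℕ}

/-- A measurable event of large probability on which an almost sure property holds and two unlikely
ones, none of them assumed to be measurable, fail. -/
lemma exists_measurableSet_of_ae_of_measure_le {P Q₁ Q₂ : Ω → Prop} (hP : ∀ᵐ ω ∂μ, P ω) {b₁ b₂ δ : ℝ}
    (h1 : μ {ω | Q₁ ω} ≤ ENNReal.ofReal b₁) (h2 : μ {ω | Q₂ ω} ≤ ENNReal.ofReal b₂)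
    (hb₁ : 0 ≤ b₁) (hb₂ : 0 ≤ b₂) (hδ : b₁ + b₂ ≤ δ) :
    ∃ E : Set Ω, MeasurableSet E ∧ ENNReal.ofReal (1 - δ) ≤ μ E ∧
      ∀ ω ∈ E, P ω ∧ ¬ Q₁ ω ∧ ¬ Q₂ ω := by
  set S : Set Ω := {ω | ¬ P ω} ∪ ({ω | Q₁ ω} ∪ {ω | Q₂ ω})
  have hS : μ S ≤ ENNReal.ofReal δ := by
    calc μ S ≤ μ {ω | ¬ P ω} + (μ {ω | Q₁ ω} + μ {ω | Q₂ ω}) :=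
          (measure_union_le _ _).trans (add_le_add le_rfl (measure_union_le _ _))
      _ ≤ 0 + (ENNReal.ofReal b₁ + ENNReal.ofReal b₂) := by
          gcongr
          exact (ae_iff.1 hP).le
      _ ≤ ENNReal.ofReal δ := by
          rw [zero_add, ← ENNReal.ofReal_add hb₁ hb₂]
          exact ENNReal.ofReal_le_ofReal hδ
  refine ⟨(toMeasurable μ S)ᶜ, (measurableSet_toMeasurable μ S).compl, ?_, ?_⟩
  · rw [prob_compl_eq_one_sub (measurableSet_toMeasurable μ S), measure_toMeasurable,
      ENNReal.ofReal_sub _ (by linarith), ENNReal.ofReal_one]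
    exact tsub_le_tsub_left hS 1
  · intro ω hω
    have h3 : ω ∉ S := fun h => hω (subset_toMeasurable μ S h)
    refine ⟨?_, fun h => h3 (Or.inr (Or.inl h)), fun h => h3 (Or.inr (Or.inr h))⟩
    by_contra h
    exact h3 (Or.inl h)

/-- With high probability, every least-squares solution is close, entry by entry, to the matrices
`e^{hA}` and `∫₀ʰ e^{tA} dt B` of the sampled system. -/
lemma IsExperiment.exists_measurableSet_entry_le [NeZero d] {A : Matrix (Fin d) (Fin d) ℝ}
    {B : Matrix (Fin d) (Fin p) ℝ} {h : ℝ} {u : Fin H → Fin (m + 2) → Ω → EuclideanSpace ℝ (Fin p)}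
    {W X : Fin H → ℝ≥0 → Ω → EuclideanSpace ℝ (Fin d)} (hE : IsExperiment μ A B h u W X)
    (hh : 0 < h) (hA : h * ‖A‖ ≤ 1 / 15) {r t δ : ℝ} (hr : 0 < r)
    (hrH : r ^ 2 ≤ ((H : ℝ) - (d + p)) / 4) (ht : 0 ≤ t)
    (hδ : (d + p) * Real.exp (-((H : ℝ) - (d + p)) / 4) +
      d * (2 * (d + p) * Real.exp (-t ^ 2 / (2 * ((1 + d) ^ 2 * h)))) ≤ δ) :
    ∃ E : Set Ω, MeasurableSet E ∧ ENNReal.ofReal (1 - δ) ≤ μ E ∧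
      ∀ ω ∈ E, ∀ (M : Matrix (Fin d) (Fin d) ℝ) (N : Matrix (Fin d) (Fin p) ℝ),
        IsLeastSquares (fun l => X l (sampleTime h (m + 1)) ω) (fun l => u l (Fin.last (m + 1)) ω)
          (fun l => X l (sampleTime h (m + 2)) ω) M N →
        (∀ i j, |((M - NormedSpace.exp (h • A)) * (√h • bridgeGain h A)) i j| ≤
          (d + p) * t * (1 + d) / r) ∧
        ∀ i k, |(N - expIntegral h A * B) i k| ≤ (d + p) * t * (1 + d) / r := by
  set U : Fin H → Ω → Fin (m + 2) → EuclideanSpace ℝ (Fin p) := fun l ω k => u l k ω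
  set w : Fin H → Ω → ℝ≥0 → EuclideanSpace ℝ (Fin d) := fun l ω t => W l t ω
  set g : Fin H → Ω → Fin d ⊕ Fin p → ℝ := fun l ω => designNoise h (U l ω) (w l ω)
  set a : Fin H → Ω → Fin d ⊕ Fin p → ℝ := fun l ω => designShift h A B (X l 0 ω) (U l ω) (w l ω)
  set e : Fin H → Ω → EuclideanSpace ℝ (Fin d) := fun l ω => pathNoise h A (incr h (m + 1) (w l ω))
  have hU : ∀ l, Measurable (U l) := fun l => measurable_pi_lambda _ (hE.measurable_input l)
  have hw : ∀ l, Measurable (w l) := fun l => (hE.brownian l).measurable_path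
  have hD : ∀ l, Measurable fun ω => (X l 0 ω, U l ω, w l ω) := fun l =>
    (hE.measurable_initial l).prodMk ((hU l).prodMk (hw l))
  have hdN : Measurable fun q : EuclideanSpace ℝ (Fin d) ×
      (Fin (m + 2) → EuclideanSpace ℝ (Fin p)) × (ℝ≥0 → EuclideanSpace ℝ (Fin d)) =>
        designNoise h q.2.1 q.2.2 := (measurable_designNoise h m).comp measurable_snd
  have hdS := measurable_designShift h A B m
  have hinc := measurable_incr (d := d) h (m + 1)
  have hdE : Measurable fun q : EuclideanSpace ℝ (Fin d) ×
      (Fin (m + 2) → EuclideanSpace ℝ (Fin p)) × (ℝ≥0 → EuclideanSpace ℝ (Fin d)) =>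
        pathNoise h A (incr h (m + 1) q.2.2) :=
    (measurable_pathNoise h A).comp (hinc.comp (measurable_snd.comp measurable_snd))
  have hg : ∀ l, Measurable (g l) := by
    intro l
    have h1 := hdN.comp (hD l)
    exact h1
  have ha : ∀ l, Measurable (a l) := by
    intro l
    have h1 := hdS.comp (hD l)
    exact h1
  have he : ∀ l, Measurable (e l) := by
    intro l
    have h1 := hdE.comp (hD l)
    exact h1
  have hind1 : iIndepFun (fun l ω => (a l ω, g l ω)) μ :=
    hE.indep_trajectories.comp
      (fun _ q => (designShift h A B q.1 q.2.1 q.2.2, designNoise h q.2.1 q.2.2))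
      fun _ => hdS.prodMk hdN
  have hind2 : iIndepFun (fun l ω => (g l ω + a l ω, e l ω)) μ :=
    hE.indep_trajectories.comp
      (fun _ q => (designNoise h q.2.1 q.2.2 + designShift h A B q.1 q.2.1 q.2.2,
        pathNoise h A (incr h (m + 1) q.2.2)))
      fun _ => (hdN.add hdS).prodMk hdE
  have hcard : (Fintype.card (Fin d ⊕ Fin p) : ℝ) = d + p := by simp
  have hbad1 := measure_norm_sum_columns_lt ha hg hind1
    (fun l => indepFun_designShift_designNoise hh A B (hE.measurable_initial l)
      (hE.measurable_input l) (hE.brownian l) (hE.indep_initial l) (hE.indep_input_noise l)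
      (hE.indep_inputs l))
    (fun l => map_designNoise hh (hE.measurable_input l) (hE.brownian l) (hE.law_input l _)
      (hE.indep_input_noise l)) (r := r) (by rwa [hcard])
  have hbad2 := measure_inner_columns_gt (fun l => (hg l).add (ha l)) he hind2
    (fun l => indepFun_design_pathNoise hh A B (hE.measurable_initial l)
      (hE.measurable_input l) (hE.brownian l) (hE.indep_initial l) (hE.indep_input_noise l))
    (fun l i => (hE.brownian l).hasSubgaussianMGF_pathNoise hh hA (m + 1) i) ht
  have hc : (((((1 + d : ℝ≥0) * NNReal.sqrt h.toNNReal) ^ 2 : ℝ≥0)) : ℝ) = (1 + d) ^ 2 * h := by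
    push_cast
    rw [mul_pow, Real.sq_sqrt (NNReal.coe_nonneg _), Real.coe_toNNReal _ hh.le]
  rw [hcard] at hbad1
  rw [hcard, hc] at hbad2
  have hgood : ∀ᵐ ω ∂μ, ∀ l, Continuous (w l ω) ∧
      SolvesSDE A B ((m + 2 : ℕ) * h) (holdInput h (U l ω)) (w l ω) fun t => X l t ω := by
    rw [ae_all_iff]
    intro l
    filter_upwards [(hE.brownian l).ae_continuous, hE.dynamics l] with ω h1 h2 using ⟨h1, h2⟩
  obtain ⟨E, hEm, hEμ, hEs⟩ := exists_measurableSet_of_ae_of_measure_le hgood hbad1 hbad2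
    (by positivity) (by positivity) hδ
  refine ⟨E, hEm, hEμ, fun ω hω M N hLS => ?_⟩
  obtain ⟨h1, h2, h3⟩ := hEs ω hω
  push Not at h2 h3
  have hx := fun l => state_eq_design hh hA (h1 l).1 (h1 l).2
  have hv : ∀ l, u l (Fin.last (m + 1)) ω =
      WithLp.toLp 2 fun k => (g l ω + a l ω) (Sum.inr k) := by
    intro l
    ext k
    simp [g, a, U, designNoise, designShift]
  have hy := fun l => sample_step hh (h1 l).1 (h1 l).2 (Fin.last (m + 1))
  exact abs_entry_le_of_isLeastSquares hx hv hy hr (by positivity) h2 h3 hLS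

/-- The entrywise bounds in terms of the spectral norm. -/
lemma norm_sub_le_of_entry_le [NeZero d] {A M Φ : Matrix (Fin d) (Fin d) ℝ}
    {N Γ : Matrix (Fin d) (Fin p) ℝ} {h β : ℝ} (hh : 0 < h) (hA : h * ‖A‖ ≤ 1 / 15)
    (hM : ∀ i j, |((M - Φ) * (√h • bridgeGain h A)) i j| ≤ β) (hN : ∀ i k, |(N - Γ) i k| ≤ β) :
    ‖M - Φ‖ ≤ 2 * ((√h)⁻¹ * (d * d * β)) ∧ ‖N - Γ‖ ≤ d * p * β := by
  refine ⟨?_, norm_le_of_abs_entry_le _ hN⟩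
  have h1 := norm_le_of_abs_entry_le _ hM
  rw [Matrix.mul_smul, norm_smul, Real.norm_of_nonneg (Real.sqrt_nonneg h)] at h1
  have h2 := norm_le_of_norm_mul_le (Y := M - Φ) (norm_bridgeGain_sub_one_le hh hA)
  have hs : 0 < √h := Real.sqrt_pos.2 hh
  have h3 : ‖(M - Φ) * bridgeGain h A‖ ≤ (√h)⁻¹ * (d * d * β) := by
    rw [inv_mul_eq_div, le_div_iff₀ hs, mul_comm]
    exact h1
  linarith

end Experiment

/-! ### Constants -/

section Constants

/-- The polynomial in `κA, κB, d, p` that gives the constant. With `n = d + p` and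
`K = 9 n⁴ (1 + d)²`, it is the sum of the bounds that the steps of the proof require. -/
noncomputable def boundPolynomial : MvPolynomial (Fin 4) ℝ :=
  let n : MvPolynomial (Fin 4) ℝ := MvPolynomial.X 2 + MvPolynomial.X 3
  let K : MvPolynomial (Fin 4) ℝ := 9 * n ^ 4 * (1 + MvPolynomial.X 2) ^ 2
  (200 * K) ^ 2 + 60 * MvPolynomial.X 0 * K + 2 * K * (1 + 15 * MvPolynomial.X 0) +
    16 * K * MvPolynomial.X 1 + 24 * n

lemma eval_boundPolynomial (κA κB d p : ℝ) :
    MvPolynomial.eval ![κA, κB, d, p] boundPolynomial =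
      (200 * (9 * (d + p) ^ 4 * (1 + d) ^ 2)) ^ 2 + 60 * κA * (9 * (d + p) ^ 4 * (1 + d) ^ 2) +
        2 * (9 * (d + p) ^ 4 * (1 + d) ^ 2) * (1 + 15 * κA) +
        16 * (9 * (d + p) ^ 4 * (1 + d) ^ 2) * κB + 24 * (d + p) := by
  simp [boundPolynomial]

/-- The exponents that make the two failure probabilities at most `δ / 2 = exp (-ℓ) / 2` each, as
`n ≤ 2 ^ n ≤ exp (n ℓ)`. -/
lemma natCast_mul_exp_le {n : ℕ} (hn : 1 ≤ n) {l : ℝ} (hl : Real.log 2 ≤ l) :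
    n * Real.exp (-(3 * n * l)) ≤ Real.exp (-l) / 2 ∧
      2 * n * n * Real.exp (-(5 * n * l)) ≤ Real.exp (-l) / 2 := by
  have hn' : (1 : ℝ) ≤ n := by exact_mod_cast hn
  have hl0 : 0 < l := (Real.log_pos one_lt_two).trans_le hl
  have h2 : 2 ≤ Real.exp l := by
    rw [← Real.exp_log two_pos]
    exact Real.exp_le_exp.2 hl
  set X := Real.exp (n * l)
  have hX0 : 0 < X := Real.exp_pos _
  have hlX : Real.exp l ≤ X := Real.exp_le_exp.2 (by nlinarith)
  have hnX : (n : ℝ) ≤ X := by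
    have h3 : (n : ℝ) ≤ 2 ^ n := by exact_mod_cast Nat.lt_two_pow_self.le
    refine h3.trans ?_
    rw [show X = Real.exp l ^ n from Real.exp_nat_mul l n]
    gcongr
  have e3 : Real.exp (-(3 * n * l)) = (X ^ 3)⁻¹ := by
    rw [← Real.exp_nat_mul, ← Real.exp_neg]
    congr 1
    push_cast
    ring
  have e5 : Real.exp (-(5 * n * l)) = (X ^ 5)⁻¹ := by
    rw [← Real.exp_nat_mul, ← Real.exp_neg]
    congr 1
    push_cast
    ring
  have e1 : X⁻¹ ≤ Real.exp (-l) := by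
    rw [Real.exp_neg]
    exact inv_anti₀ (Real.exp_pos _) hlX
  have h2X : 2 ≤ X := h2.trans hlX
  rw [e3, e5]
  constructor
  · calc n * (X ^ 3)⁻¹ = n * 2 * (X ^ 3)⁻¹ / 2 := by ring
      _ ≤ X * X * (X ^ 3)⁻¹ / 2 := by gcongr
      _ = X⁻¹ / 2 := by field_simp
      _ ≤ _ := by gcongr
  · calc 2 * n * n * (X ^ 5)⁻¹ = n * n * 2 * 2 * (X ^ 5)⁻¹ / 2 := by ring
      _ ≤ X * X * X * X * (X ^ 5)⁻¹ / 2 := by gcongr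
      _ = X⁻¹ / 2 := by field_simp
      _ ≤ _ := by gcongr

end Constants

section Final

variable {Ω : Type*} [MeasurableSpace Ω] {μ : Measure Ω} [IsProbabilityMeasure μ] {d p H m : ℕ}

/-- With high probability, the spectral errors of the discrete-time matrices are at most a multiple of
`√(ℓ / H)`, where `ℓ = log (1 / δ)`. -/
lemma IsExperiment.exists_measurableSet_norm_le [NeZero d] {A : Matrix (Fin d) (Fin d) ℝ}
    {B : Matrix (Fin d) (Fin p) ℝ} {h : ℝ} {u : Fin H → Fin (m + 2) → Ω → EuclideanSpace ℝ (Fin p)}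
    {W X : Fin H → ℝ≥0 → Ω → EuclideanSpace ℝ (Fin d)} (hE : IsExperiment μ A B h u W X)
    (hh : 0 < h) (hA : h * ‖A‖ ≤ 1 / 15) {l : ℝ} (hl : Real.log 2 ≤ l)
    (hH : 24 * (d + p) * l ≤ H) :
    ∃ E : Set Ω, MeasurableSet E ∧ ENNReal.ofReal (1 - Real.exp (-l)) ≤ μ E ∧
      ∀ ω ∈ E, ∀ (M : Matrix (Fin d) (Fin d) ℝ) (N : Matrix (Fin d) (Fin p) ℝ),
        IsLeastSquares (fun l => X l (sampleTime h (m + 1)) ω) (fun l => u l (Fin.last (m + 1)) ω)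
          (fun l => X l (sampleTime h (m + 2)) ω) M N →
        ‖M - NormedSpace.exp (h • A)‖ ≤ 2 * (9 * (d + p) ^ 4 * (1 + d) ^ 2) * √(l / H) ∧
        ‖N - expIntegral h A * B‖ ≤ (9 * (d + p) ^ 4 * (1 + d) ^ 2) * √h * √(l / H) := by
  set n : ℝ := d + p with hn
  have hd : (1 : ℝ) ≤ d := by exact_mod_cast NeZero.one_le
  have hp : (0 : ℝ) ≤ p := p.cast_nonneg
  have hn1 : 1 ≤ n := by linarith
  have hl' : 1 / 2 < l := by linarith [Real.log_two_gt_d9]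
  have hnl : n ≤ n * (2 * l) := by nlinarith
  have hHn : 12 * n ≤ H := by linarith
  have hH0 : (0 : ℝ) < H := by linarith
  set r : ℝ := √(H / 8) with hr
  set t : ℝ := √(10 * ((1 + d) ^ 2 * h) * n * l) with ht
  have hr0 : 0 < r := Real.sqrt_pos.2 (by positivity)
  have hr2 : r ^ 2 = H / 8 := Real.sq_sqrt (by positivity)
  have ht2 : t ^ 2 = 10 * ((1 + d) ^ 2 * h) * n * l := Real.sq_sqrt (by positivity)
  have hexp := natCast_mul_exp_le (n := d + p) (by have := NeZero.one_le (n := d); omega) hl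
  push_cast at hexp
  rw [← hn] at hexp
  -- With `r² = H / 8` and `t² = 10 (1 + d)² h n l`, the exponents are those of `natCast_mul_exp_le`.
  obtain ⟨E, hEm, hEμ, hEs⟩ := hE.exists_measurableSet_entry_le (r := r) (t := t)
    (δ := Real.exp (-l)) hh hA hr0 (by rw [hr2]; linarith) (Real.sqrt_nonneg _) (by
      rw [← hn, ht2]
      have h1 : n * Real.exp (-((H : ℝ) - n) / 4) ≤ n * Real.exp (-(3 * n * l)) := by
        gcongr
        linarith
      have h2 : -(10 * ((1 + d) ^ 2 * h) * n * l) / (2 * ((1 + d) ^ 2 * h)) = -(5 * n * l) := by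
        field_simp
        norm_num
      have h3 : d * (2 * n * Real.exp (-(5 * n * l))) ≤ 2 * n * n * Real.exp (-(5 * n * l)) := by
        have : d * (2 * n * Real.exp (-(5 * n * l))) ≤ n * (2 * n * Real.exp (-(5 * n * l))) := by
          gcongr
          linarith
        linarith
      rw [h2]
      linarith [hexp.1, hexp.2])
  refine ⟨E, hEm, hEμ, fun ω hω M N hLS => ?_⟩
  obtain ⟨hM, hN⟩ := hEs ω hω M N hLS
  obtain ⟨h1, h2⟩ := norm_sub_le_of_entry_le hh hA hM hN
  set q := √(l / H)
  have hq0 : 0 ≤ q := Real.sqrt_nonneg _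
  have hs0 : 0 < √h := Real.sqrt_pos.2 hh
  -- `t / r = (1 + d) √h √(80 n) √(l / H)`, and `80 n ≤ (9 n)²`.
  have htr : t / r ≤ 9 * n * (1 + d) * √h * q := by
    have h3 : t ≤ 9 * n * (1 + d) * √h * q * r := by
      refine abs_le_of_sq_le_sq' ?_ (by positivity) |>.2
      have h4 : (9 * n * (1 + d) * √h * q * r) ^ 2 = 81 * n ^ 2 * ((1 + d) ^ 2 * h) * l / 8 := by
        simp only [mul_pow]
        rw [Real.sq_sqrt hh.le, hr2, Real.sq_sqrt (by positivity)]
        field_simp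
        norm_num
      rw [ht2, h4]
      have h5 : n ≤ n ^ 2 := by nlinarith
      have h6 : 0 ≤ (1 + d : ℝ) ^ 2 * h * l := by positivity
      nlinarith [mul_le_mul_of_nonneg_right h5 h6]
    exact (div_le_iff₀ hr0).2 h3
  have hβ : n * t * (1 + d) / r ≤ 9 * n ^ 2 * (1 + d) ^ 2 * √h * q := by
    calc n * t * (1 + d) / r = n * (1 + d) * (t / r) := by ring
      _ ≤ n * (1 + d) * (9 * n * (1 + d) * √h * q) := by gcongr
      _ = _ := by ring
  have hβ0 : 0 ≤ n * t * (1 + d) / r := by positivity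
  have hdn : (d : ℝ) ≤ n := by linarith
  have hpn : (p : ℝ) ≤ n := by linarith
  constructor
  · refine h1.trans ?_
    calc 2 * ((√h)⁻¹ * (d * d * (n * t * (1 + d) / r)))
        ≤ 2 * ((√h)⁻¹ * (n * n * (9 * n ^ 2 * (1 + d) ^ 2 * √h * q))) := by gcongr
      _ = _ := by
        field_simp
  · refine h2.trans ?_
    calc d * p * (n * t * (1 + d) / r)
        ≤ n * n * (9 * n ^ 2 * (1 + d) ^ 2 * √h * q) := by gcongr
      _ = _ := by ring

end Final

end ContinuousSysID

theorem theorem3 :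
    ∃ P : MvPolynomial (Fin 4) ℝ,
      ∀ (d p : ℕ) (κA κB : ℝ), 0 < κA →
      ∀ (A : Matrix (Fin d) (Fin d) ℝ) (B : Matrix (Fin d) (Fin p) ℝ),
      ‖A‖ ≤ κA → ‖B‖ ≤ κB →
      ∀ h : ℝ, h = 1 / (15 * κA) →
      ∀ C : ℝ, C = MvPolynomial.eval ![κA, κB, (d : ℝ), (p : ℝ)] P →
      ∀ (T₀ : ℕ) (hT₀ : 2 ≤ T₀), T₀ ≤ 10 →
      ∀ (H : ℕ) (δ : ℝ), 0 < δ → δ < 1 / 2 → C * Real.log (1 / δ) ≤ H →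
      ∀ {Ω : Type*} [MeasurableSpace Ω] (μ : Measure Ω) [IsProbabilityMeasure μ]
        (u : Fin H → Fin T₀ → Ω → EuclideanSpace ℝ (Fin p))
        (W X : Fin H → ℝ≥0 → Ω → EuclideanSpace ℝ (Fin d)),
      ContinuousSysID.IsExperiment μ A B h u W X →
      ∃ E : Set Ω, MeasurableSet E ∧ ENNReal.ofReal (1 - δ) ≤ μ E ∧
        ∀ ω ∈ E, ∀ (M : Matrix (Fin d) (Fin d) ℝ) (N : Matrix (Fin d) (Fin p) ℝ),
          ContinuousSysID.IsLeastSquares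
            (fun l => X l (ContinuousSysID.sampleTime h (T₀ - 1)) ω)
            (fun l => u l ⟨T₀ - 1, by omega⟩ ω)
            (fun l => X l (ContinuousSysID.sampleTime h T₀) ω) M N →
          Summable (ContinuousSysID.logTerm M) ∧
          IsUnit (ContinuousSysID.expIntegral h (ContinuousSysID.recoverA h M)) ∧
          ‖ContinuousSysID.recoverA h M - A‖ ≤ C * √(Real.log (1 / δ) / H) ∧
          ‖ContinuousSysID.recoverB h M N - B‖ ≤ C * √(Real.log (1 / δ) / H) := by
  refine ⟨ContinuousSysID.boundPolynomial, ?_⟩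
  intro d p κA κB hκA A B hA hB h hh C hC T₀ hT₀ _ H δ hδ hδ2 hH Ω _ μ _ u W X hE
  obtain ⟨m, rfl⟩ : ∃ m, T₀ = m + 2 := ⟨T₀ - 2, by omega⟩
  have hκB : 0 ≤ κB := (norm_nonneg _).trans hB
  rw [ContinuousSysID.eval_boundPolynomial] at hC
  set l := Real.log (1 / δ)
  set q := √(l / H) with hq
  have hq0 : 0 ≤ q := Real.sqrt_nonneg _
  have hC0 : 0 ≤ C := by rw [hC]; positivity
  -- For `d = 0` there is only one matrix of each shape, and the identity has norm `0`.
  rcases Nat.eq_zero_or_pos d with rfl | hd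
  · refine ⟨univ, MeasurableSet.univ, ?_, fun ω _ M N _ => ⟨?_, isUnit_of_subsingleton _, ?_, ?_⟩⟩
    · rw [measure_univ]
      exact ENNReal.ofReal_le_one.2 (by linarith)
    · exact (summable_zero).congr fun k => Subsingleton.elim _ _
    · rw [Subsingleton.elim (ContinuousSysID.recoverA h M - A) 0, norm_zero]
      positivity
    · rw [Subsingleton.elim (ContinuousSysID.recoverB h M N - B) 0, norm_zero]
      positivity
  have : NeZero d := ⟨hd.ne'⟩
  have hh0 : 0 < h := by rw [hh]; positivity
  have hhκ : h * κA = 1 / 15 := by rw [hh]; field_simp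
  have hhA : h * ‖A‖ ≤ 1 / 15 := by rw [← hhκ]; gcongr
  have hl : Real.log 2 ≤ l := by
    refine Real.log_le_log two_pos ?_
    rw [le_div_iff₀ hδ]
    linarith
  have hl0 : 0 < l := (Real.log_pos one_lt_two).trans_le hl
  have hδl : Real.exp (-l) = δ := by
    rw [← Real.log_inv, one_div, inv_inv, Real.exp_log hδ]
  have hd1 : (1 : ℝ) ≤ d := by exact_mod_cast hd
  set n : ℝ := d + p with hn
  have hn0 : 0 < n := by positivity
  set K : ℝ := 9 * n ^ 4 * (1 + d) ^ 2
  have hK0 : 0 < K := by positivity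
  have h24 : 24 * n * l ≤ H := by
    refine le_trans ?_ hH
    gcongr
    rw [hC]
    have : 0 ≤ (200 * K) ^ 2 + 60 * κA * K + 2 * K * (1 + 15 * κA) + 16 * K * κB := by positivity
    linarith
  have h200 : (200 * K) ^ 2 * l ≤ H := by
    refine le_trans ?_ hH
    gcongr
    rw [hC]
    have : 0 ≤ 60 * κA * K + 2 * K * (1 + 15 * κA) + 16 * K * κB + 24 * n := by positivity
    linarith
  have hH0 : (0 : ℝ) < H := lt_of_lt_of_le (by positivity) h24
  have hε : 2 * K * q ≤ 1 / 100 := by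
    have h1 : (200 * K * q) ^ 2 ≤ 1 ^ 2 := by
      rw [mul_pow, Real.sq_sqrt (by positivity), one_pow, ← mul_div_assoc, div_le_one hH0]
      exact h200
    have h2 := abs_le_of_sq_le_sq' h1 zero_le_one |>.2
    linarith
  obtain ⟨E, hEm, hEμ, hEs⟩ := hE.exists_measurableSet_norm_le hh0 hhA hl h24
  rw [hδl] at hEμ
  refine ⟨E, hEm, hEμ, fun ω hω M N hLS => ?_⟩
  obtain ⟨hM, hN⟩ := hEs ω hω M N hLS
  obtain ⟨h1, h2, h3, h4⟩ := ContinuousSysID.recover_stable hh0 hhA hε hM hN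
  have hhinv : h⁻¹ = 15 * κA := by rw [hh, one_div, inv_inv]
  refine ⟨h1, h2, h3.trans ?_, h4.trans ?_⟩
  · calc 2 * (2 * K * q) / h = 60 * κA * K * q := by rw [div_eq_mul_inv, hhinv]; ring
      _ ≤ C * q := by
        gcongr
        rw [hC]
        have : 0 ≤ (200 * K) ^ 2 + 2 * K * (1 + 15 * κA) + 16 * K * κB + 24 * n := by positivity
        linarith
  · have hs : h⁻¹ * √h ≤ 1 + 15 * κA := by
      -- `h⁻¹ √h = √(h⁻¹)`, and `√x ≤ 1 + x`.
      have h5 : h⁻¹ * √h = √h⁻¹ := by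
        rw [Real.sqrt_inv, inv_mul_eq_div, Real.sqrt_div_self']
        simp
      rw [h5, hhinv]
      refine Real.sqrt_le_iff.2 ⟨by positivity, ?_⟩
      have h6 : (1 + 15 * κA) ^ 2 = 1 + 2 * (15 * κA) + (15 * κA) ^ 2 := by ring
      have h7 := sq_nonneg (15 * κA)
      rw [h6]
      linarith
    calc 2 / h * (K * √h * q + 4 * h * (2 * K * q) * ‖B‖)
        = 2 * K * (h⁻¹ * √h) * q + 16 * K * ‖B‖ * q := by field_simp; ring
      _ ≤ 2 * K * (1 + 15 * κA) * q + 16 * K * κB * q := by gcongr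
      _ = (2 * K * (1 + 15 * κA) + 16 * K * κB) * q := by ring
      _ ≤ C * q := by
        gcongr
        rw [hC]
        have : 0 ≤ (200 * K) ^ 2 + 60 * κA * K + 24 * n := by positivity
        linarith
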